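/- Let $\eta(\tau)=e^{\pi i\tau/12}\prod_{n\ge1}(1-e^{2\pi i n\tau})$, for $\operatorname{Im}\tau>0$, be the Dedekind eta function, and for each positive integer $N$ let $$S_N(\tau)=\frac{\eta(N\tau)^{\varphi(N)}}{\prod_{d\mid N}\eta(d\tau)^{\mu(d)}},$$ where $\varphi$ is Euler's totient function, $\mu$ is the Möbius function, and the product is over the positive divisors $d$ of $N$. The function $S_N$ is holomorphic on the upper half-plane, has period $24$, and is bounded as $\operatorname{Im}\tau\to\infty$, and so has a Fourier expansion $$S_N(\tau)=\sum_{m\ge 0} a_N(m)\,e^{2\pi i m\tau/24}.$$ Then, for every positive integer $N$, this expansion converges to $S_N(\tau)$ for all $\tau$ with $\operatorname{Im}\tau>0$, and all its Fourier coefficients $a_N(m)$, $m\ge0$, are nonnegative real numbers. -/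

import Mathlib

open scoped UpperHalfPlane

/-- The eta product `S_N(τ) = η(Nτ)^{φ(N)} / ∏_{d ∣ N} η(dτ)^{μ(d)}` on the upper half plane,
where `η` is the Dedekind eta function. -/
noncomputable def saitoEtaProduct (N : ℕ) (τ : ℍ) : ℂ :=
  ModularForm.eta (N * (τ : ℂ)) ^ Nat.totient N /
    ∏ d ∈ N.divisors, ModularForm.eta (d * (τ : ℂ)) ^ (ArithmeticFunction.moebius d : ℤ)

/-- The `m`-th Fourier coefficient of `S_N`, a function of period `24` on the upper half plane:
the coefficient of `q^{m/24} = exp(2πimτ/24)` in its `q`-expansion at infinity. -/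
noncomputable def saitoFourierCoeff (N m : ℕ) : ℂ :=
  (UpperHalfPlane.qExpansion 24 (saitoEtaProduct N)).coeff m

/-! Put `w = exp(2πiτ/24)` and `q = w ^ 24`. Möbius inversion turns the eta product into `w ^ e *
F_N(q)`, where `F_N(q)` is `(q ^ N; q ^ N) ^ φ(N)` divided by the product of `1 - q ^ m` over `m`
coprime to `N`, and `e = N φ(N) - ∑ d μ(d)` is nonnegative (`abs_sum_mul_moebius_le_totient`). It
remains to see that `F_N` has nonnegative coefficients (`nonnegExpansion_coprimeProd`).

Let `p` be the least prime factor of `N = M p`. If `p ∣ M`, then `F_N` is `F_M` times the `φ(M)`-th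
power of the `p`-core generating function `(q ^ p; q ^ p) ^ p / (q; q)` taken at `q ^ M`. If `M =
1`, then `F_N` is that generating function itself. Otherwise `M ≥ 3`, and pairing the reduced
residues `± a` modulo `M` splits `F_N` into quotients of theta functions, one for each pair
(`nonnegExpansion_qPochPair`).

Two theta identities give positivity. The core generating function is a sum of `q ^ coreForm n` over
vectors of sum zero (`hasSum_cores`). Each theta quotient is a core generating function times a
multiple theta series (`tsum_coreTheta_mul_thetaSeries`) whose exponents are nonnegative. Both rest
on the Jacobi triple product `thetaSeries_eq`. -/

open Filter Topology

/-! ### Triangular numbers, infinite products and theta series. -/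

/-- The triangular number `n(n-1)/2` of an integer `n`. -/
def tri (n : ℤ) : ℤ := n * (n - 1) / 2

lemma two_mul_tri (n : ℤ) : 2 * tri n = n * (n - 1) := by
  unfold tri
  refine Int.mul_ediv_cancel' ?_
  have := Int.even_mul_pred_self n
  exact this.two_dvd

lemma tri_add (m n : ℤ) : tri (m + n) = tri m + tri n + m * n := by
  have h1 := two_mul_tri (m + n)
  have h2 := two_mul_tri m
  have h3 := two_mul_tri n
  nlinarith

lemma tri_nonneg (n : ℤ) : 0 ≤ tri n := by
  have h1 := two_mul_tri n
  rcases le_or_gt n 0 with h | h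
  · nlinarith
  · nlinarith

lemma tri_add_one (n : ℤ) : tri (n + 1) = tri n + n := by
  have h1 := two_mul_tri n
  have h2 := two_mul_tri (n + 1)
  linarith

lemma tri_natCast_succ (n : ℕ) : tri ((n + 1 : ℕ) : ℤ) = tri n + n := by
  push_cast; exact tri_add_one n

lemma tri_neg (n : ℤ) : tri (-n) = tri n + n := by
  have h1 := two_mul_tri n
  have h2 := two_mul_tri (-n)
  linarith

/-- The infinite product `∏ (1 - z q ^ n)` over `n ≥ 0`. -/
noncomputable def qPoch (z q : ℂ) : ℂ := ∏' n : ℕ, (1 - z * q ^ n)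

/-- The theta series `∑ (-1) ^ n z ^ n q ^ (n (n - 1) / 2)` over `n ∈ ℤ`. -/
noncomputable def thetaSeries (z q : ℂ) : ℂ := ∑' n : ℤ, (-1) ^ n * z ^ n * q ^ tri n

lemma multipliable_qPoch (z : ℂ) {q : ℂ} (hq : ‖q‖ < 1) :
    Multipliable fun n : ℕ => 1 - z * q ^ n := by
  have : Summable fun n : ℕ => ‖-(z * q ^ n)‖ := by
    simpa using (summable_geometric_of_lt_one (norm_nonneg _) hq).mul_left ‖z‖
  simpa [sub_eq_add_neg] using multipliable_one_add_of_summable this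

lemma qPoch_ne_zero {z q : ℂ} (hq : ‖q‖ < 1) (h : ∀ n : ℕ, z * q ^ n ≠ 1) :
    qPoch z q ≠ 0 := by
  have : Summable fun n : ℕ => ‖-(z * q ^ n)‖ := by
    simpa using (summable_geometric_of_lt_one (norm_nonneg _) hq).mul_left ‖z‖
  have h2 := tprod_one_add_ne_zero_of_summable (f := fun n : ℕ => -(z * q ^ n))
    (fun n h0 => h n (by linear_combination -h0)) this
  simpa [qPoch, sub_eq_add_neg] using h2

lemma qPoch_ne_zero_of_norm_lt {z q : ℂ} (hq : ‖q‖ < 1) (hz : ‖z‖ < 1) : qPoch z q ≠ 0 := by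
  refine qPoch_ne_zero hq fun n h => ?_
  have h1 : ‖z * q ^ n‖ < 1 := by
    rw [norm_mul, norm_pow]
    exact mul_lt_one_of_nonneg_of_lt_one_left (norm_nonneg _) hz
      (pow_le_one₀ (norm_nonneg _) hq.le)
  rw [h] at h1
  simp at h1

lemma tendsto_prod_qPoch (z : ℂ) {q : ℂ} (hq : ‖q‖ < 1) :
    Tendsto (fun m : ℕ => ∏ n ∈ Finset.range m, (1 - z * q ^ n)) atTop (𝓝 (qPoch z q)) :=
  (multipliable_qPoch z hq).hasProd.tendsto_prod_nat

lemma summable_theta_nat (x : ℝ) {y : ℝ} (hx : 0 < x) (hy0 : 0 < y) (hy : y < 1) :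
    Summable fun n : ℕ => x ^ n * y ^ tri n := by
  refine summable_of_ratio_test_tendsto_lt_one (l := 0) one_pos
    (Eventually.of_forall fun n => by positivity) ?_
  have : (fun n : ℕ => ‖x ^ (n + 1) * y ^ tri ((n + 1 : ℕ) : ℤ)‖ / ‖x ^ n * y ^ tri n‖) =
      fun n : ℕ => x * y ^ n := by
    funext n
    have h1 : y ^ tri n ≠ 0 := (zpow_pos hy0 _).ne'
    have h2 : x ^ n ≠ 0 := (pow_pos hx _).ne'
    rw [tri_natCast_succ, zpow_add₀ hy0.ne', Real.norm_of_nonneg (by positivity),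
      Real.norm_of_nonneg (by positivity), zpow_natCast, pow_succ]
    field_simp
  rw [this]
  simpa using (tendsto_pow_atTop_nhds_zero_of_lt_one hy0.le hy).const_mul x

lemma summable_theta_real {x y : ℝ} (hx : 0 < x) (hy0 : 0 < y) (hy : y < 1) :
    Summable fun n : ℤ => x ^ n * y ^ tri n := by
  refine Summable.of_nat_of_neg ?_ ?_
  · simpa using summable_theta_nat x hx hy0 hy
  · refine (summable_theta_nat (x⁻¹ * y) (by positivity) hy0 hy).congr fun n => ?_
    rw [tri_neg, zpow_add₀ hy0.ne', zpow_neg, zpow_natCast, zpow_natCast, mul_pow, inv_pow]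
    ring

lemma summable_norm_theta {z q : ℂ} (hz : z ≠ 0) (hq0 : q ≠ 0) (hq : ‖q‖ < 1) :
    Summable fun n : ℤ => ‖(-1) ^ n * z ^ n * q ^ tri n‖ := by
  simpa using summable_theta_real (norm_pos_iff.2 hz) (norm_pos_iff.2 hq0) hq

/-! ### The Jacobi triple product, as a limit of its finite form. -/

/-- The finite `q`-Pochhammer symbol `∏ (1 - q ^ k)` over `1 ≤ k ≤ n`. -/
noncomputable def qFactorial (q : ℂ) (n : ℕ) : ℂ := ∏ k ∈ Finset.range n, (1 - q * q ^ k)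

/-- The reciprocal of `qFactorial`, extended by zero to negative integers. -/
noncomputable def qFactorialInv (q : ℂ) (n : ℤ) : ℂ :=
  if 0 ≤ n then (qFactorial q n.toNat)⁻¹ else 0

lemma one_sub_pow_ne_zero {q : ℂ} (hq : ‖q‖ < 1) (k : ℕ) : 1 - q * q ^ k ≠ 0 := by
  intro h
  have h1 : ‖q ^ (k + 1)‖ < 1 := by
    rw [norm_pow]; exact pow_lt_one₀ (norm_nonneg _) hq (by simp)
  rw [pow_succ', ← sub_eq_zero.1 h] at h1
  simp at h1

/-- Extension by zero is consistent at `n = 0` because `1 - q ^ 0 = 0`; the coefficient recurrence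
then needs no boundary cases. -/
lemma qFactorialInv_sub_one {q : ℂ} (hq : ‖q‖ < 1) (n : ℤ) :
    qFactorialInv q (n - 1) = (1 - q ^ n) * qFactorialInv q n := by
  rcases lt_trichotomy n 0 with h | h | h
  · rw [qFactorialInv, qFactorialInv, if_neg (by lia), if_neg (by lia), mul_zero]
  · simp [qFactorialInv, h]
  · obtain ⟨k, rfl⟩ : ∃ k : ℕ, n = k + 1 := ⟨(n - 1).toNat, by lia⟩
    have h1 : (0 : ℤ) ≤ k + 1 := by lia
    have h2 : ((k : ℤ) + 1).toNat = k + 1 := by lia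
    simp only [qFactorialInv, add_sub_cancel_right, Int.natCast_nonneg, if_true, h1, h2,
      Int.toNat_natCast]
    have h3 : q ^ ((k : ℤ) + 1) = q * q ^ k := by
      rw [← pow_succ']; exact_mod_cast zpow_natCast q (k + 1)
    have h4 := one_sub_pow_ne_zero hq k
    rw [h3, qFactorial, qFactorial, Finset.prod_range_succ, mul_inv]
    field_simp

lemma tendsto_qFactorial {q : ℂ} (hq : ‖q‖ < 1) :
    Tendsto (qFactorial q) atTop (𝓝 (qPoch q q)) := tendsto_prod_qPoch q hq

lemma norm_qFactorialInv_bounded {q : ℂ} (hq : ‖q‖ < 1) :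
    ∃ C : ℝ, ∀ n : ℤ, ‖qFactorialInv q n‖ ≤ C := by
  have h := ((tendsto_qFactorial hq).inv₀ (qPoch_ne_zero_of_norm_lt hq hq)).norm
  obtain ⟨C, hC⟩ := h.bddAbove_range
  refine ⟨max C 0, fun n => ?_⟩
  unfold qFactorialInv
  split_ifs with h0
  · exact (hC ⟨n.toNat, rfl⟩).trans (le_max_left _ _)
  · simp

lemma norm_qFactorial_bounded {q : ℂ} (hq : ‖q‖ < 1) :
    ∃ C : ℝ, ∀ n : ℕ, ‖qFactorial q n‖ ≤ C := by
  obtain ⟨C, hC⟩ := (tendsto_qFactorial hq).norm.bddAbove_range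
  exact ⟨C, fun n => hC ⟨n, rfl⟩⟩

lemma tendsto_qFactorialInv {q : ℂ} (hq : ‖q‖ < 1) {u : ℕ → ℤ} (hu : Tendsto u atTop atTop) :
    Tendsto (fun m => qFactorialInv q (u m)) atTop (𝓝 (qPoch q q)⁻¹) := by
  have h1 : Tendsto (fun n : ℤ => (qFactorial q n.toNat)⁻¹) atTop (𝓝 (qPoch q q)⁻¹) :=
    ((tendsto_qFactorial hq).inv₀ (qPoch_ne_zero_of_norm_lt hq hq)).comp
      (tendsto_atTop.2 fun b => (eventually_ge_atTop (b : ℤ)).mono fun a ha => by lia)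
  refine (h1.comp hu).congr' ?_
  filter_upwards [hu.eventually_ge_atTop 0] with m hm
  simp [qFactorialInv, hm]

/-- The coefficient of `z ^ n` in the finite form of the triple product. -/
noncomputable def finiteThetaCoeff (q : ℂ) (m : ℕ) (n : ℤ) : ℂ :=
  (-1) ^ n * q ^ tri n * (qFactorial q (2 * m) * qFactorialInv q (m + n) * qFactorialInv q (m - n))

/-- A `q`-Pascal rule: multiplication by `(1 - z q ^ m) (1 - q ^ (m + 1) / z)`, read off on the
coefficient of `z ^ n`. -/
lemma finiteThetaCoeff_succ {q : ℂ} (hq0 : q ≠ 0) (hq : ‖q‖ < 1) (m : ℕ) (n : ℤ) :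
    finiteThetaCoeff q (m + 1) n = (1 + q * q ^ (2 * m)) * finiteThetaCoeff q m n
      - q ^ m * finiteThetaCoeff q m (n - 1) - q ^ (m + 1) * finiteThetaCoeff q m (n + 1) := by
  have e1 : qFactorialInv q (m + n) = (1 - q ^ ((m : ℤ) + 1 + n)) *
      qFactorialInv q ((m : ℤ) + 1 + n) := by
    rw [← qFactorialInv_sub_one hq]; congr 1; ring
  have e2 : qFactorialInv q (m - n) = (1 - q ^ ((m : ℤ) + 1 - n)) *
      qFactorialInv q ((m : ℤ) + 1 - n) := by
    rw [← qFactorialInv_sub_one hq]; congr 1; ring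
  have e3 : qFactorialInv q (m + (n - 1)) = (1 - q ^ ((m : ℤ) + n)) * qFactorialInv q (m + n) := by
    rw [← qFactorialInv_sub_one hq]; congr 1; ring
  have e4 : qFactorialInv q (m - (n + 1)) = (1 - q ^ ((m : ℤ) - n)) * qFactorialInv q (m - n) := by
    rw [← qFactorialInv_sub_one hq]; congr 1; ring
  have e5 : (m : ℤ) - (n - 1) = m + 1 - n := by ring
  have e6 : (m : ℤ) + (n + 1) = m + 1 + n := by ring
  have t1 : tri (n - 1) = tri n - (n - 1) := by
    have := tri_add_one (n - 1); rw [sub_add_cancel] at this; linarith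
  have hn : q ^ n ≠ 0 := zpow_ne_zero _ hq0
  have s1 : ((-1 : ℂ)) ^ (n - 1) = -(-1) ^ n := by
    rw [zpow_sub₀ (by norm_num)]; simp [div_neg]
  have s2 : ((-1 : ℂ)) ^ (n + 1) = -(-1) ^ n := by
    rw [zpow_add₀ (by norm_num)]; simp
  have f1 : qFactorial q (2 * (m + 1)) =
      qFactorial q (2 * m) * (1 - q * q ^ (2 * m)) * (1 - q * q ^ (2 * m + 1)) := by
    unfold qFactorial
    rw [show 2 * (m + 1) = 2 * m + 1 + 1 by ring, Finset.prod_range_succ, Finset.prod_range_succ]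
  unfold finiteThetaCoeff
  rw [f1, e3, e4, e5, e6, e1, e2, t1, tri_add_one, s1, s2]
  push_cast
  generalize qFactorialInv q ((m : ℤ) + 1 + n) = R
  generalize qFactorialInv q ((m : ℤ) + 1 - n) = S
  generalize qFactorial q (2 * m) = A
  simp only [zpow_add₀ hq0, zpow_sub₀ hq0, zpow_natCast, zpow_one, pow_mul, pow_add, pow_one]
  generalize q ^ tri n = U
  generalize ((-1 : ℂ)) ^ n = V
  have : (q ^ 2) ^ m = q ^ m * q ^ m := by rw [← pow_mul, two_mul, pow_add]
  rw [this]
  field_simp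
  ring

lemma finiteThetaCoeff_eq_zero {q : ℂ} {m : ℕ} {n : ℤ} (h : n ∉ Finset.Icc (-m : ℤ) m) :
    finiteThetaCoeff q m n = 0 := by
  rw [Finset.mem_Icc, not_and_or] at h
  unfold finiteThetaCoeff qFactorialInv
  rcases h with h | h
  · rw [if_neg (show ¬ (0 : ℤ) ≤ m + n by lia)]; simp
  · rw [if_neg (show ¬ (0 : ℤ) ≤ m - n by lia)]; simp

lemma hasSum_finiteTheta {z q : ℂ} (hz : z ≠ 0) (hq0 : q ≠ 0) (hq : ‖q‖ < 1) (m : ℕ) :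
    HasSum (fun n : ℤ => z ^ n * finiteThetaCoeff q m n)
      ((∏ k ∈ Finset.range m, (1 - z * q ^ k)) * ∏ k ∈ Finset.range m, (1 - q / z * q ^ k)) := by
  induction m with
  | zero =>
    have : HasSum (fun n : ℤ => z ^ n * finiteThetaCoeff q 0 n)
        (z ^ (0 : ℤ) * finiteThetaCoeff q 0 0) := by
      refine hasSum_single 0 fun n hn => ?_
      rw [finiteThetaCoeff_eq_zero (by simpa using hn), mul_zero]
    simpa [finiteThetaCoeff, qFactorial, qFactorialInv, tri] using this
  | succ m ih =>
    have h1 := (Equiv.subRight (1 : ℤ)).hasSum_iff.2 ih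
    have h2 := (Equiv.addRight (1 : ℤ)).hasSum_iff.2 ih
    rw [Finset.prod_range_succ, Finset.prod_range_succ]
    generalize (∏ k ∈ Finset.range m, (1 - z * q ^ k)) = X at *
    generalize (∏ k ∈ Finset.range m, (1 - q / z * q ^ k)) = Y at *
    have h3 := ((ih.mul_left (1 + q * q ^ (2 * m))).sub (h1.mul_left (z * q ^ m))).sub
      (h2.mul_left (q / z * q ^ m))
    have e1 : X * (1 - z * q ^ m) * (Y * (1 - q / z * q ^ m)) = (1 + q * q ^ (2 * m)) * (X * Y) -
        z * q ^ m * (X * Y) - q / z * q ^ m * (X * Y) := by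
      rw [mul_comm 2 m, pow_mul]
      field_simp
      ring
    rw [e1]
    refine h3.congr_fun fun n => ?_
    simp only [Function.comp_apply, Equiv.subRight_apply, Equiv.coe_addRight]
    rw [finiteThetaCoeff_succ hq0 hq, zpow_sub₀ hz, zpow_add₀ hz, zpow_one]
    generalize finiteThetaCoeff q m n = A
    generalize finiteThetaCoeff q m (n - 1) = B
    generalize finiteThetaCoeff q m (n + 1) = C
    field_simp
    ring

/-- The Jacobi triple product identity. -/
theorem thetaSeries_eq {z q : ℂ} (hz : z ≠ 0) (hq0 : q ≠ 0) (hq : ‖q‖ < 1) :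
    thetaSeries z q = qPoch q q * qPoch z q * qPoch (q / z) q := by
  obtain ⟨C, hC⟩ := norm_qFactorialInv_bounded hq
  obtain ⟨D, hD⟩ := norm_qFactorial_bounded hq
  have hC0 : 0 ≤ C := (norm_nonneg _).trans (hC 0)
  have hD0 : 0 ≤ D := (norm_nonneg _).trans (hD 0)
  have he := qPoch_ne_zero_of_norm_lt hq hq
  -- The `q`-binomial factor tends to `1 / (q; q)` and is bounded uniformly in `m` and `n`, so the
  -- theta series dominates.
  have key : Tendsto (fun m : ℕ => ∑' n : ℤ, z ^ n * finiteThetaCoeff q m n) atTop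
      (𝓝 (∑' n : ℤ, (-1) ^ n * z ^ n * q ^ tri n * (qPoch q q)⁻¹)) := by
    refine tendsto_tsum_of_dominated_convergence
      (bound := fun n : ℤ => ‖(-1) ^ n * z ^ n * q ^ tri n‖ * (D * C * C))
      ((summable_norm_theta hz hq0 hq).mul_right _) (fun n => ?_)
      (Eventually.of_forall fun m n => ?_)
    · have h1 : Tendsto (fun m : ℕ => qFactorial q (2 * m)) atTop (𝓝 (qPoch q q)) :=
        (tendsto_qFactorial hq).comp (tendsto_id.const_mul_atTop' (by norm_num))
      have h2 : Tendsto (fun m : ℕ => qFactorialInv q (m + n)) atTop (𝓝 (qPoch q q)⁻¹) :=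
        tendsto_qFactorialInv hq (tendsto_atTop_add_const_right _ _ tendsto_natCast_atTop_atTop)
      have h3 : Tendsto (fun m : ℕ => qFactorialInv q (m - n)) atTop (𝓝 (qPoch q q)⁻¹) :=
        tendsto_qFactorialInv hq (by
          simpa [sub_eq_add_neg] using
            tendsto_atTop_add_const_right _ (-n) tendsto_natCast_atTop_atTop)
      have h4 := ((h1.mul h2).mul h3).const_mul (z ^ n * ((-1) ^ n * q ^ tri n))
      rw [mul_inv_cancel₀ he, one_mul] at h4
      refine (h4.congr fun m => ?_).trans_eq ?_
      · simp only [finiteThetaCoeff]; ring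
      · congr 1; ring
    · have : z ^ n * finiteThetaCoeff q m n = (-1) ^ n * z ^ n * q ^ tri n *
          (qFactorial q (2 * m) * qFactorialInv q (m + n) * qFactorialInv q (m - n)) := by
        simp only [finiteThetaCoeff]; ring
      rw [this, norm_mul]
      refine mul_le_mul_of_nonneg_left ?_ (norm_nonneg _)
      rw [norm_mul, norm_mul]
      gcongr
      exacts [hD _, hC _, hC _]
  have h5 := (tendsto_prod_qPoch z hq).mul (tendsto_prod_qPoch (q / z) hq)
  have h6 : (fun m : ℕ => ∑' n : ℤ, z ^ n * finiteThetaCoeff q m n) = fun m : ℕ =>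
      (∏ k ∈ Finset.range m, (1 - z * q ^ k)) * ∏ k ∈ Finset.range m, (1 - q / z * q ^ k) :=
    funext fun m => (hasSum_finiteTheta hz hq0 hq m).tsum_eq
  rw [h6] at key
  have h7 := tendsto_nhds_unique key h5
  rw [tsum_mul_right] at h7
  rw [thetaSeries, mul_assoc, ← h7]
  field_simp

/-- The factors are sorted by the residue of the exponent modulo `t`. -/
lemma qPoch_eq_prod (z : ℂ) {q : ℂ} (hq : ‖q‖ < 1) {t : ℕ} (ht : 0 < t) :
    qPoch z q = ∏ i ∈ Finset.range t, qPoch (z * q ^ i) (q ^ t) := by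
  have hqt : ‖q ^ t‖ < 1 := by
    rw [norm_pow]; exact pow_lt_one₀ (norm_nonneg _) hq ht.ne'
  have h1 : Tendsto (fun m : ℕ => ∏ n ∈ Finset.range (m * t), (1 - z * q ^ n)) atTop
      (𝓝 (qPoch z q)) :=
    (tendsto_prod_qPoch z hq).comp (tendsto_id.atTop_mul_const' ht)
  have h2 := tendsto_finsetProd (Finset.range t)
    (fun i _ => tendsto_prod_qPoch (z * q ^ i) hqt)
  refine tendsto_nhds_unique h1 (h2.congr fun m => ?_)
  induction m with
  | zero => simp
  | succ m ih =>
    rw [add_mul, one_mul, Finset.prod_range_add, ← ih, ← Finset.prod_mul_distrib]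
    refine Finset.prod_congr rfl fun i _ => ?_
    rw [Finset.prod_range_succ, pow_add, mul_comm m t, pow_mul]
    ring

/-! ### Products over sets of exponents, and products of absolutely convergent series. -/

/-- The product of `1 - q ^ m` over `m ∈ A`. -/
noncomputable def setProd (A : Set ℕ) (q : ℂ) : ℂ :=
  ∏' m : ℕ, A.mulIndicator (fun m => 1 - q ^ m) m

lemma mulIndicator_eq_one_add (A : Set ℕ) (q : ℂ) :
    A.mulIndicator (fun m => 1 - q ^ m) = fun m => 1 + A.indicator (fun m => -q ^ m) m := by
  funext m
  by_cases h : m ∈ A <;> simp [h, sub_eq_add_neg]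

lemma summable_norm_indicator (A : Set ℕ) {q : ℂ} (hq : ‖q‖ < 1) :
    Summable fun m => ‖A.indicator (fun m => -q ^ m) m‖ := by
  have h := (summable_geometric_of_lt_one (norm_nonneg _) hq).indicator A
  refine h.congr fun m => ?_
  by_cases h : m ∈ A <;> simp [h]

lemma multipliable_setProd (A : Set ℕ) {q : ℂ} (hq : ‖q‖ < 1) :
    Multipliable (A.mulIndicator fun m => 1 - q ^ m) := by
  rw [mulIndicator_eq_one_add]
  exact multipliable_one_add_of_summable (summable_norm_indicator A hq)

lemma setProd_ne_zero {A : Set ℕ} {q : ℂ} (hq : ‖q‖ < 1) (hA : 0 ∉ A) : setProd A q ≠ 0 := by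
  unfold setProd
  rw [mulIndicator_eq_one_add]
  refine tprod_one_add_ne_zero_of_summable (fun m h => ?_) (summable_norm_indicator A hq)
  by_cases hm : m ∈ A
  · have hm0 : m ≠ 0 := fun h0 => hA (h0 ▸ hm)
    have : ‖q ^ m‖ < 1 := by rw [norm_pow]; exact pow_lt_one₀ (norm_nonneg _) hq hm0
    rw [Set.indicator_of_mem hm, ← sub_eq_add_neg, sub_eq_zero] at h
    rw [← h] at this
    simp at this
  · simp [hm] at h

lemma setProd_union {A B : Set ℕ} (h : Disjoint A B) {q : ℂ} (hq : ‖q‖ < 1) :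
    setProd (A ∪ B) q = setProd A q * setProd B q := by
  unfold setProd
  rw [← (multipliable_setProd A hq).tprod_mul (multipliable_setProd B hq),
    Set.mulIndicator_union_of_disjoint h]

lemma setProd_biUnion {ι : Type*} (I : Finset ι) (s : ι → Set ℕ)
    (h : (I : Set ι).PairwiseDisjoint s) {q : ℂ} (hq : ‖q‖ < 1) :
    setProd (⋃ i ∈ I, s i) q = ∏ i ∈ I, setProd (s i) q := by
  unfold setProd
  rw [← Multipliable.tprod_finsetProd fun i _ => multipliable_setProd (s i) hq,
    Finset.mulIndicator_biUnion I s h]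

lemma setProd_range {g : ℕ → ℕ} (hg : g.Injective) (q : ℂ) :
    setProd (Set.range g) q = ∏' k, (1 - q ^ g k) := by
  rw [setProd, ← tprod_subtype, tprod_range (fun m => 1 - q ^ m) hg]

lemma setProd_image_mul (A : Set ℕ) {d : ℕ} (hd : 0 < d) (q : ℂ) :
    setProd ((d * ·) '' A) q = setProd A (q ^ d) := by
  have hg : Function.Injective (d * · : ℕ → ℕ) := fun a b h => Nat.eq_of_mul_eq_mul_left hd h
  rw [setProd, ← tprod_subtype, tprod_image (fun m => 1 - q ^ m) hg.injOn, setProd, ← tprod_subtype]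
  simp only [pow_mul]

lemma setProd_progression {a M : ℕ} (hM : 0 < M) (q : ℂ) :
    setProd (Set.range fun k => a + M * k) q = qPoch (q ^ a) (q ^ M) := by
  rw [setProd_range (fun a b h => by simpa [hM.ne'] using h)]
  simp only [qPoch, pow_add, pow_mul]

lemma setProd_ne_zero_eq (q : ℂ) : setProd {m | m ≠ 0} q = qPoch q q := by
  have : {m : ℕ | m ≠ 0} = Set.range fun k => 1 + 1 * k := by
    ext m
    simp only [Set.mem_ofPred_eq, Set.mem_range]
    exact ⟨fun h => ⟨m - 1, by lia⟩, by rintro ⟨k, rfl⟩; lia⟩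
  rw [this, setProd_progression one_pos, pow_one]

lemma summable_hasSum_mul {α β : Type*} {f : α → ℂ} {g : β → ℂ} {x y : ℂ}
    (hf : Summable fun a => ‖f a‖) (hfx : HasSum f x) (hg : Summable fun b => ‖g b‖)
    (hgy : HasSum g y) :
    Summable (fun p : α × β => ‖f p.1 * g p.2‖) ∧
      HasSum (fun p : α × β => f p.1 * g p.2) (x * y) :=
  ⟨hf.mul_norm hg, hfx.mul hgy (hf.mul_norm hg).of_norm⟩

lemma summable_hasSum_pi {r : ℕ} (f : Fin r → ℤ → ℂ) (hf : ∀ i, Summable fun n => ‖f i n‖) :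
    Summable (fun n : Fin r → ℤ => ‖∏ i, f i (n i)‖) ∧
    HasSum (fun n : Fin r → ℤ => ∏ i, f i (n i)) (∏ i, ∑' k, f i k) := by
  induction r with
  | zero => exact ⟨(hasSum_unique _).summable, by simp⟩
  | succ r ih =>
    obtain ⟨h1, h2⟩ := ih (fun i => f i.succ) fun i => hf i.succ
    let e : ℤ × (Fin r → ℤ) ≃ (Fin (r + 1) → ℤ) := Fin.consEquiv (fun _ : Fin (r + 1) => ℤ)
    have hfun : ∀ p, ∏ i, f i (e p i) = f 0 p.1 * ∏ i, f i.succ (p.2 i) := fun p => by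
      simp [e, Fin.consEquiv, Fin.prod_univ_succ]
    obtain ⟨h3, h4⟩ := summable_hasSum_mul (hf 0) (hf 0).of_norm.hasSum h1 h2
    constructor
    · rw [← e.summable_iff]
      exact h3.congr fun p => congrArg norm (hfun p).symm
    · rw [← e.hasSum_iff, Fin.prod_univ_succ]
      exact h4.congr_fun hfun

/-! ### Functions with nonnegative power series coefficients. -/

/-- `f` agrees on the punctured unit disc with a power series whose coefficients are
nonnegative real numbers. -/
def NonnegExpansion (f : ℂ → ℂ) : Prop :=
  ∃ a : ℕ → ℝ, (∀ n, 0 ≤ a n) ∧ ∀ q : ℂ, q ≠ 0 → ‖q‖ < 1 → HasSum (fun n => (a n : ℂ) * q ^ n) (f q)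

namespace NonnegExpansion

lemma of_hasSum {ι : Type*} {f : ℂ → ℂ} (c : ι → ℝ) (hc : ∀ i, 0 ≤ c i) (e : ι → ℕ)
    (h : ∀ q : ℂ, q ≠ 0 → ‖q‖ < 1 → HasSum (fun i => (c i : ℂ) * q ^ e i) (f q)) :
    NonnegExpansion f := by
  refine ⟨fun n => ∑' i : e ⁻¹' {n}, c i, fun n => tsum_nonneg fun i => hc i, fun q h0 hq => ?_⟩
  refine ((h q h0 hq).tsum_fiberwise e).congr_fun fun n => ?_
  rw [Complex.ofReal_tsum, ← tsum_mul_right]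
  refine tsum_congr fun i => ?_
  rw [show e i = n from i.2]

lemma of_hasSum_zpow {ι : Type*} {f : ℂ → ℂ} (e : ι → ℤ) (he : ∀ i, 0 ≤ e i)
    (h : ∀ q : ℂ, q ≠ 0 → ‖q‖ < 1 → HasSum (fun i => q ^ e i) (f q)) : NonnegExpansion f := by
  refine of_hasSum (fun _ => 1) (fun _ => zero_le_one) (fun i => (e i).toNat) fun q h0 hq => ?_
  refine (h q h0 hq).congr_fun fun i => ?_
  rw [← zpow_natCast, Int.toNat_of_nonneg (he i)]
  simp

lemma congr {f g : ℂ → ℂ} (hf : NonnegExpansion f)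
    (h : ∀ q : ℂ, q ≠ 0 → ‖q‖ < 1 → f q = g q) : NonnegExpansion g := by
  obtain ⟨a, ha, hs⟩ := hf
  exact ⟨a, ha, fun q h0 hq => h q h0 hq ▸ hs q h0 hq⟩

lemma pow_self (k : ℕ) : NonnegExpansion fun q => q ^ k :=
  of_hasSum (ι := Unit) (fun _ => 1) (fun _ => zero_le_one) (fun _ => k) fun q _ _ => by
    simp

lemma one : NonnegExpansion fun _ => 1 := by simpa using pow_self 0

lemma mul {f g : ℂ → ℂ} (hf : NonnegExpansion f) (hg : NonnegExpansion g) :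
    NonnegExpansion fun q => f q * g q := by
  obtain ⟨a, ha, hs⟩ := hf
  obtain ⟨b, hb, ht⟩ := hg
  refine of_hasSum (fun p : ℕ × ℕ => a p.1 * b p.2) (fun p => mul_nonneg (ha _) (hb _))
    (fun p => p.1 + p.2) fun q h0 hq => ?_
  have h1 := hs q h0 hq
  have h2 := ht q h0 hq
  refine (h1.mul h2 (h1.summable.norm.mul_norm h2.summable.norm).of_norm).congr_fun fun p => ?_
  push_cast
  ring

lemma pow {f : ℂ → ℂ} (hf : NonnegExpansion f) (k : ℕ) : NonnegExpansion fun q => f q ^ k := by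
  induction k with
  | zero => simpa using one
  | succ k ih => simpa only [pow_succ] using ih.mul hf

lemma prod {ι : Type*} (s : Finset ι) {f : ι → ℂ → ℂ} (hf : ∀ i ∈ s, NonnegExpansion (f i)) :
    NonnegExpansion fun q => ∏ i ∈ s, f i q := by
  classical
  induction s using Finset.induction_on with
  | empty => simpa using one
  | insert i s hi ih =>
    simp only [Finset.prod_insert hi]
    exact (hf i (Finset.mem_insert_self i s)).mul
      (ih fun j hj => hf j (Finset.mem_insert_of_mem hj))

lemma comp_pow {f : ℂ → ℂ} (hf : NonnegExpansion f) {k : ℕ} (hk : 0 < k) :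
    NonnegExpansion fun q => f (q ^ k) := by
  obtain ⟨a, ha, hs⟩ := hf
  refine of_hasSum a ha (fun n => k * n) fun q h0 hq => ?_
  simp only [pow_mul]
  refine hs _ (pow_ne_zero _ h0) ?_
  rw [norm_pow]
  exact pow_lt_one₀ (norm_nonneg _) hq hk.ne'

end NonnegExpansion

lemma norm_pow_lt_one {q : ℂ} (hq : ‖q‖ < 1) {t : ℕ} (ht : 0 < t) : ‖q ^ t‖ < 1 := by
  rw [norm_pow]; exact pow_lt_one₀ (norm_nonneg _) hq ht.ne'

/-! ### Zeros and quasi-periodicity of theta; the multiple theta series. -/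

lemma thetaSeries_one {q : ℂ} (hq0 : q ≠ 0) (hq : ‖q‖ < 1) : thetaSeries 1 q = 0 := by
  have : qPoch 1 q = 0 := tprod_of_exists_eq_zero ⟨0, by simp⟩
  rw [thetaSeries_eq one_ne_zero hq0 hq, this]
  ring

lemma thetaSeries_zpow_mul {z q : ℂ} (hz : z ≠ 0) (hq0 : q ≠ 0) (j : ℤ) :
    thetaSeries (q ^ (-j) * z) q = q ^ (-tri (-j)) * (-1) ^ j * z ^ j * thetaSeries z q := by
  unfold thetaSeries
  rw [← (Equiv.subRight j).tsum_eq (fun n : ℤ => (-1) ^ n * z ^ n * q ^ tri n), ← tsum_mul_left]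
  refine tsum_congr fun n => ?_
  have h1 : tri (n - j) = tri n + tri (-j) - n * j := by
    rw [sub_eq_add_neg, tri_add]; ring
  have h2 : ((-1 : ℂ)) ^ j * (-1) ^ j = 1 := by
    rw [← mul_zpow]; simp
  have h3 : ((-1 : ℂ)) ^ (n - j) = (-1) ^ n * (-1) ^ j := by
    rw [zpow_sub₀ (by norm_num), div_eq_iff (zpow_ne_zero _ (by norm_num)), mul_assoc, h2, mul_one]
  rw [Equiv.subRight_apply, h1, h3, mul_zpow, ← zpow_mul, zpow_sub₀ hz, zpow_sub₀ hq0,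
    zpow_add₀ hq0, zpow_neg q (tri (-j)), show -j * n = -(n * j) by ring, zpow_neg q (n * j)]
  have h4 : z ^ j ≠ 0 := zpow_ne_zero _ hz
  have h5 : q ^ tri (-j) ≠ 0 := zpow_ne_zero _ hq0
  field_simp
  rw [pow_two, h2]

lemma thetaSeries_zpow_self {q : ℂ} (hq0 : q ≠ 0) (hq : ‖q‖ < 1) (j : ℤ) :
    thetaSeries (q ^ j) q = 0 := by
  have := thetaSeries_zpow_mul one_ne_zero hq0 (-j)
  rw [thetaSeries_one hq0 hq, mul_zero, neg_neg, mul_one] at this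
  exact this

/-- The exponent of the multiple theta series attached to `r + 1` cores. -/
def coreExponent {r : ℕ} (n : Fin r → ℤ) : ℤ :=
  ∑ i, ((r + 1) * tri (n i) + (i + 1) * n i) - tri (∑ i, n i + 1)

/-- Iterated, this writes `coreExponent n` as the sum of all `tri (n i)` and of all `tri (n i - n
j)` with `i < j`, which is where positivity comes from. -/
lemma coreExponent_cons {r : ℕ} (x : ℤ) (m : Fin r → ℤ) :
    coreExponent (Fin.cons x m : Fin (r + 1) → ℤ) =
      coreExponent m + tri x + ∑ i, tri (x - m i) := by
  unfold coreExponent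
  have h1 : ∀ i, tri (x - m i) = tri x + (tri (m i) + m i) - x * m i := fun i => by
    rw [sub_eq_add_neg, tri_add, tri_neg]; ring
  have h2 : tri (x + ∑ i, m i + 1) = tri x + tri (∑ i, m i + 1) + x * (∑ i, m i + 1) := by
    rw [add_assoc, tri_add]
  simp only [h1, Fin.sum_univ_succ, Fin.cons_zero, Fin.cons_succ, Finset.sum_sub_distrib,
    Finset.sum_add_distrib, ← Finset.mul_sum, h2, Finset.sum_const, Finset.card_univ,
    Fintype.card_fin, Fin.val_zero, Fin.val_succ, add_mul, one_mul, nsmul_eq_mul]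
  push_cast
  simp only [add_mul, one_mul, Finset.sum_add_distrib]
  ring

lemma sum_tri_le_coreExponent {r : ℕ} (n : Fin r → ℤ) : ∑ i, tri (n i) ≤ coreExponent n := by
  induction r with
  | zero => simp [coreExponent, tri]
  | succ r ih =>
    rw [← Fin.cons_self_tail n, coreExponent_cons, Fin.sum_univ_succ]
    have h1 := ih (Fin.tail n)
    have h2 : 0 ≤ ∑ i, tri (n 0 - Fin.tail n i) := Finset.sum_nonneg fun i _ => tri_nonneg _
    simp only [Fin.cons_zero, Fin.cons_succ]
    linarith

lemma coreExponent_nonneg {r : ℕ} (n : Fin r → ℤ) : 0 ≤ coreExponent n :=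
  (Finset.sum_nonneg fun _ _ => tri_nonneg _).trans (sum_tri_le_coreExponent n)

lemma coreExponent_add_sum_nonneg {r : ℕ} (n : Fin r → ℤ) : 0 ≤ coreExponent n + ∑ i, n i := by
  have h1 := sum_tri_le_coreExponent n
  have h2 : 0 ≤ ∑ i, (tri (n i) + n i) := Finset.sum_nonneg fun i _ => by
    rw [← tri_neg]; exact tri_nonneg _
  rw [Finset.sum_add_distrib] at h2
  linarith

lemma prod_zpow_eq_zpow_sum {ι : Type*} (s : Finset ι) {q : ℂ} (hq0 : q ≠ 0) (f : ι → ℤ) :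
    ∏ i ∈ s, q ^ f i = q ^ ∑ i ∈ s, f i := by
  classical
  induction s using Finset.induction_on with
  | empty => simp
  | insert i s hi ih => rw [Finset.prod_insert hi, Finset.sum_insert hi, zpow_add₀ hq0, ih]

lemma summable_norm_coreTheta {z q : ℂ} (hz : z ≠ 0) (hq0 : q ≠ 0) (hq : ‖q‖ < 1) (r : ℕ) :
    Summable fun n : Fin r → ℤ => ‖z ^ (∑ i, n i) * q ^ coreExponent n‖ := by
  have h := (summable_hasSum_pi (r := r) (fun _ n => (-1) ^ n * z ^ n * q ^ tri n)
    fun _ => summable_norm_theta hz hq0 hq).1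
  refine h.of_nonneg_of_le (fun _ => norm_nonneg _) fun n => ?_
  rw [Finset.prod_mul_distrib, Finset.prod_mul_distrib, prod_zpow_eq_zpow_sum _ hz,
    prod_zpow_eq_zpow_sum _ hq0, norm_mul, norm_mul, norm_mul]
  have h1 : ‖∏ i, (-1 : ℂ) ^ n i‖ = 1 := by simp [norm_prod]
  rw [h1, one_mul, norm_zpow q, norm_zpow q]
  refine mul_le_mul_of_nonneg_left ?_ (norm_nonneg _)
  exact zpow_le_zpow_right_of_le_one₀ (norm_pos_iff.2 hq0) hq.le (sum_tri_le_coreExponent n)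

/-- The equivalence `(k, n) ↦ (n, k - ∑ n)`. -/
def subSumEquiv (r : ℕ) : ℤ × (Fin r → ℤ) ≃ (Fin r → ℤ) × ℤ where
  toFun p := (p.2, p.1 - ∑ i, p.2 i)
  invFun p := (p.2 + ∑ i, p.1 i, p.1)
  left_inv p := by simp
  right_inv p := by simp

/-- With total `z`-degree `k` fixed, the cross terms of `tri (k - ∑ n)` cancel those of `tri (∑ n +
1)`, so the sum over `n` factors into one-variable theta series. -/
lemma coreTheta_mul_term {z q : ℂ} (hz : z ≠ 0) (hq0 : q ≠ 0) {r : ℕ} (k : ℤ) (n : Fin r → ℤ) :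
    z ^ (∑ i, n i) * q ^ coreExponent n *
      ((-1) ^ (k - ∑ i, n i) * z ^ (k - ∑ i, n i) * q ^ tri (k - ∑ i, n i)) =
    (-1) ^ k * z ^ k * q ^ tri k * ∏ i : Fin r, ((-1) ^ n i * (q ^ ((i : ℤ) + 1 - k)) ^ n i *
      (q ^ (r + 1)) ^ tri (n i)) := by
  have h1 : ∀ i : Fin r, (q ^ ((i : ℤ) + 1 - k)) ^ n i * (q ^ (r + 1)) ^ tri (n i) =
      q ^ (((i : ℤ) + 1 - k) * n i + (r + 1) * tri (n i)) := fun i => by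
    rw [zpow_add₀ hq0, zpow_mul, zpow_mul]
    congr 2
  have h2 : coreExponent n + tri (k - ∑ i, n i) =
      tri k + ∑ i : Fin r, (((i : ℤ) + 1 - k) * n i + (r + 1) * tri (n i)) := by
    have h3 : tri (k - ∑ i, n i) = tri k + tri (∑ i, n i + 1) - k * ∑ i, n i := by
      rw [sub_eq_add_neg, tri_add, tri_neg, tri_add_one]; ring
    rw [coreExponent, h3]
    simp only [Finset.sum_add_distrib, sub_mul, add_mul, one_mul, Finset.sum_sub_distrib,
      ← Finset.mul_sum]
    ring
  have hm : ((-1 : ℂ)) ≠ 0 := by norm_num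
  have h4 : ((-1 : ℂ)) ^ (k - ∑ i, n i) = (-1) ^ k * (-1) ^ ∑ i, n i := by
    rw [zpow_sub₀ hm, div_eq_iff (zpow_ne_zero _ hm), mul_assoc, ← mul_zpow]; simp
  simp only [mul_assoc, h1, Finset.prod_mul_distrib, prod_zpow_eq_zpow_sum _ hq0,
    prod_zpow_eq_zpow_sum _ hm]
  have h5 : q ^ coreExponent n * q ^ tri (k - ∑ i, n i) = q ^ tri k *
      q ^ ∑ i : Fin r, (((i : ℤ) + 1 - k) * n i + (r + 1) * tri (n i)) := by
    rw [← zpow_add₀ hq0, h2, zpow_add₀ hq0]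
  have h6 : z ^ (∑ i, n i) * z ^ (k - ∑ i, n i) = z ^ k := by
    rw [← zpow_add₀ hz]; congr 1; ring
  rw [h4]
  linear_combination (-1) ^ k * (-1) ^ (∑ i, n i) * z ^ (∑ i, n i) * z ^ (k - ∑ i, n i) * h5 +
    (-1) ^ k * (-1) ^ (∑ i, n i) * q ^ tri k *
      q ^ (∑ i : Fin r, (((i : ℤ) + 1 - k) * n i + (r + 1) * tri (n i))) * h6

/-- The numbers `i + 1` cover all nonzero residues modulo `r + 1`, so some factor is theta at an
integral power of its own nome, which is a zero. -/
lemma prod_thetaSeries_eq_zero {q : ℂ} (hq0 : q ≠ 0) (hq : ‖q‖ < 1) {r : ℕ} {k : ℤ}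
    (hk : ¬ ((r : ℤ) + 1) ∣ k) :
    ∏ i : Fin r, thetaSeries (q ^ ((i : ℤ) + 1 - k)) (q ^ (r + 1)) = 0 := by
  have h0 : (0 : ℤ) < r + 1 := by lia
  have h1 := Int.emod_nonneg k h0.ne'
  have h2 := Int.emod_lt_of_pos k h0
  have h3 : k % (r + 1) ≠ 0 := fun h => hk (Int.dvd_of_emod_eq_zero h)
  refine Finset.prod_eq_zero (Finset.mem_univ ⟨(k % (r + 1)).toNat - 1, by lia⟩) ?_
  have h4 : ((((k % (r + 1)).toNat - 1 : ℕ) : ℤ) + 1 - k) = (r + 1) * (-(k / (r + 1))) := by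
    have := Int.emod_add_mul_ediv k (r + 1)
    rw [mul_neg]
    lia
  have h5 : q ^ (((r : ℤ) + 1) * (-(k / (r + 1)))) = (q ^ (r + 1)) ^ (-(k / ((r : ℤ) + 1))) := by
    rw [zpow_mul]; congr 1
  simp only [h4, h5]
  exact thetaSeries_zpow_self (pow_ne_zero _ hq0) (norm_pow_lt_one hq (by lia)) _

lemma prod_thetaSeries_shift {q : ℂ} (hq0 : q ≠ 0) {r : ℕ} (j : ℤ) :
    (-1) ^ (((r : ℤ) + 1) * j) * q ^ tri (((r : ℤ) + 1) * j) *
      ∏ i : Fin r, thetaSeries (q ^ ((i : ℤ) + 1 - ((r : ℤ) + 1) * j)) (q ^ (r + 1)) =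
    (-1) ^ j * (q ^ (r + 1)) ^ tri j * ∏ i : Fin r, thetaSeries (q ^ ((i : ℕ) + 1)) (q ^ (r + 1)) := by
  have hW : ∀ x : ℤ, (q ^ (r + 1)) ^ x = q ^ (((r : ℤ) + 1) * x) := fun x => by
    rw [zpow_mul]; congr 1
  have h1 : ∀ i : Fin r, thetaSeries (q ^ ((i : ℤ) + 1 - ((r : ℤ) + 1) * j)) (q ^ (r + 1)) =
      q ^ (((i : ℤ) + 1) * j - (r + 1) * tri (-j)) * (-1) ^ j *
        thetaSeries (q ^ ((i : ℕ) + 1)) (q ^ (r + 1)) := fun i => by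
    have h2 : q ^ ((i : ℤ) + 1) = q ^ ((i : ℕ) + 1) := by exact_mod_cast zpow_natCast q (i + 1)
    have h3 : q ^ ((i : ℤ) + 1 - ((r : ℤ) + 1) * j) =
        (q ^ (r + 1)) ^ (-j) * q ^ ((i : ℕ) + 1) := by
      rw [hW, ← h2, ← zpow_add₀ hq0]; congr 1; ring
    rw [h3, thetaSeries_zpow_mul (pow_ne_zero _ hq0) (pow_ne_zero _ hq0), hW, ← h2, ← zpow_mul,
      mul_neg, zpow_neg, zpow_sub₀ hq0 (((i : ℤ) + 1) * j)]
    ring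
  have hm : ((-1 : ℂ)) ≠ 0 := by norm_num
  have h4 : ((-1 : ℂ)) ^ (((r : ℤ) + 1) * j) * ((-1) ^ j) ^ r = (-1) ^ j := by
    rw [← zpow_natCast, ← zpow_mul, ← zpow_add₀ hm,
      show ((r : ℤ) + 1) * j + j * r = j + 2 * (r * j) by ring, zpow_add₀ hm, zpow_mul (-1) 2]
    simp
  have h6 : ∑ i : Fin r, ((i : ℤ) + 1) * 2 = (r : ℤ) * (r + 1) := by
    have := Finset.sum_range_id_mul_two (r + 1)
    rw [Finset.sum_range_succ', add_zero, Finset.sum_mul,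
      ← Fin.sum_univ_eq_sum_range (fun i => (i + 1) * 2)] at this
    rw [add_tsub_cancel_right] at this
    zify at this
    linarith
  have h5 : tri (((r : ℤ) + 1) * j) + ∑ i : Fin r, (((i : ℤ) + 1) * j - (r + 1) * tri (-j)) =
      (r + 1) * tri j := by
    rw [Finset.sum_sub_distrib, ← Finset.sum_mul, Finset.sum_const, Finset.card_univ,
      Fintype.card_fin, tri_neg, nsmul_eq_mul]
    rw [← Finset.sum_mul] at h6
    have a1 := two_mul_tri (((r : ℤ) + 1) * j)
    have a2 := two_mul_tri j
    have : 2 * (tri (((r : ℤ) + 1) * j) + ((∑ i : Fin r, ((i : ℤ) + 1)) * j -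
        r * ((r + 1) * (tri j + j)))) = 2 * ((r + 1) * tri j) := by
      linear_combination a1 + j * h6 - (r + 1) * (r + 1) * a2
    linarith
  simp only [h1, Finset.prod_mul_distrib, prod_zpow_eq_zpow_sum _ hq0, Finset.prod_const,
    Finset.card_univ, Fintype.card_fin, hW]
  rw [← h5, zpow_add₀ hq0]
  linear_combination q ^ tri (((r : ℤ) + 1) * j) *
    q ^ (∑ i : Fin r, (((i : ℤ) + 1) * j - (r + 1) * tri (-j))) *
    (∏ i : Fin r, thetaSeries (q ^ ((i : ℕ) + 1)) (q ^ (r + 1))) * h4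

/-- The multiple theta series refining the generating function of `r + 1` cores is a quotient
of theta series. -/
theorem tsum_coreTheta_mul_thetaSeries {z q : ℂ} (hz : z ≠ 0) (hq0 : q ≠ 0) (hq : ‖q‖ < 1)
    (r : ℕ) :
    (∑' n : Fin r → ℤ, z ^ (∑ i, n i) * q ^ coreExponent n) * thetaSeries z q =
      thetaSeries (z ^ (r + 1)) (q ^ (r + 1)) *
        ∏ i : Fin r, thetaSeries (q ^ ((i : ℕ) + 1)) (q ^ (r + 1)) := by
  have hW0 : q ^ (r + 1) ≠ 0 := pow_ne_zero _ hq0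
  have hW : ‖q ^ (r + 1)‖ < 1 := norm_pow_lt_one hq (by lia)
  have hs1 := summable_norm_coreTheta hz hq0 hq r
  have hs2 := summable_norm_theta hz hq0 hq
  have hs3 : Summable fun p : ℤ × (Fin r → ℤ) => (-1) ^ p.1 * z ^ p.1 * q ^ tri p.1 *
      ∏ i : Fin r, ((-1) ^ p.2 i * (q ^ ((i : ℤ) + 1 - p.1)) ^ p.2 i *
        (q ^ (r + 1)) ^ tri (p.2 i)) := by
    have h := ((subSumEquiv r).summable_iff).2 (summable_mul_of_summable_norm hs1 hs2)
    exact h.congr fun p => coreTheta_mul_term hz hq0 p.1 p.2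
  have h1 : ∀ k : ℤ, ∑' n : Fin r → ℤ, (-1) ^ k * z ^ k * q ^ tri k *
      ∏ i : Fin r, ((-1) ^ n i * (q ^ ((i : ℤ) + 1 - k)) ^ n i * (q ^ (r + 1)) ^ tri (n i)) =
      (-1) ^ k * z ^ k * q ^ tri k *
        ∏ i : Fin r, thetaSeries (q ^ ((i : ℤ) + 1 - k)) (q ^ (r + 1)) := fun k => by
    rw [tsum_mul_left]
    congr 1
    exact (summable_hasSum_pi (fun (i : Fin r) (n : ℤ) => (-1) ^ n *
      (q ^ ((i : ℤ) + 1 - k)) ^ n * (q ^ (r + 1)) ^ tri n)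
      fun i => summable_norm_theta (zpow_ne_zero _ hq0) hW0 hW).2.tsum_eq
  have h0 : ((r : ℤ) + 1) ≠ 0 := by lia
  rw [thetaSeries, tsum_mul_tsum_of_summable_norm hs1 hs2, ← (subSumEquiv r).tsum_eq]
  simp only [subSumEquiv, Equiv.coe_fn_mk, coreTheta_mul_term hz hq0]
  rw [hs3.tsum_prod]
  simp only [h1]
  -- Only the `k` divisible by `r + 1` contribute; `k = (r + 1) j` yields the `j`-th term of theta
  -- at `z ^ (r + 1)`.
  rw [← (mul_right_injective₀ h0).tsum_eq, thetaSeries, ← tsum_mul_right]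
  · refine tsum_congr fun j => ?_
    have h2 : (z ^ (r + 1)) ^ j = z ^ (((r : ℤ) + 1) * j) := by
      rw [zpow_mul]; congr 1
    rw [h2]
    linear_combination z ^ (((r : ℤ) + 1) * j) * prod_thetaSeries_shift hq0 (r := r) j
  · intro k hk
    by_contra h
    refine hk ?_
    beta_reduce
    rw [prod_thetaSeries_eq_zero hq0 hq fun ⟨j, hj⟩ => h ⟨j, hj.symm⟩, mul_zero]

lemma prod_qPoch_succ {q : ℂ} (hq : ‖q‖ < 1) (r : ℕ) :
    ∏ i ∈ Finset.range r, qPoch (q ^ (i + 1)) (q ^ (r + 1)) =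
      qPoch q q / qPoch (q ^ (r + 1)) (q ^ (r + 1)) := by
  have hW : ‖q ^ (r + 1)‖ < 1 := norm_pow_lt_one hq (by lia)
  rw [eq_div_iff (qPoch_ne_zero_of_norm_lt hW hW), qPoch_eq_prod q hq r.succ_pos,
    Finset.prod_range_succ]
  simp only [pow_succ']

/-- The two `z`-dependent factors of the triple product each run over the nonzero residues modulo `r
+ 1`, the second in reverse order; hence the square. -/
lemma prod_thetaSeries_succ {q : ℂ} (hq0 : q ≠ 0) (hq : ‖q‖ < 1) (r : ℕ) :
    ∏ i : Fin r, thetaSeries (q ^ ((i : ℕ) + 1)) (q ^ (r + 1)) =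
      qPoch (q ^ (r + 1)) (q ^ (r + 1)) ^ r *
        (qPoch q q / qPoch (q ^ (r + 1)) (q ^ (r + 1))) ^ 2 := by
  have hW : ‖q ^ (r + 1)‖ < 1 := norm_pow_lt_one hq (by lia)
  have hW0 : q ^ (r + 1) ≠ 0 := pow_ne_zero _ hq0
  rw [Fin.prod_univ_eq_prod_range (fun i => thetaSeries (q ^ (i + 1)) (q ^ (r + 1))) r,
    Finset.prod_congr rfl fun i _ => thetaSeries_eq (pow_ne_zero _ hq0) hW0 hW,
    Finset.prod_mul_distrib, Finset.prod_mul_distrib, Finset.prod_const, Finset.card_range,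
    prod_qPoch_succ hq, ← Finset.prod_range_reflect]
  have h : ∀ i ∈ Finset.range r, qPoch (q ^ (r + 1) / q ^ (r - 1 - i + 1)) (q ^ (r + 1)) =
      qPoch (q ^ (i + 1)) (q ^ (r + 1)) := fun i hi => by
    have hi := Finset.mem_range.1 hi
    rw [div_eq_iff (pow_ne_zero _ hq0) |>.2]
    rw [← pow_add]; congr 1; lia
  rw [Finset.prod_congr rfl h, prod_qPoch_succ hq]
  ring

lemma prod_thetaSeries_neg {q : ℂ} (hq0 : q ≠ 0) (hq : ‖q‖ < 1) (r : ℕ) :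
    ∏ i : Fin (r + 1), thetaSeries (-q ^ (i : ℕ)) (q ^ (r + 1)) =
      qPoch (q ^ (r + 1)) (q ^ (r + 1)) ^ (r + 1) / qPoch q q * thetaSeries (-1) q := by
  have hW : ‖q ^ (r + 1)‖ < 1 := norm_pow_lt_one hq (by lia)
  have hW0 : q ^ (r + 1) ≠ 0 := pow_ne_zero _ hq0
  have he := qPoch_ne_zero_of_norm_lt hq hq
  rw [Fin.prod_univ_eq_prod_range (fun i => thetaSeries (-q ^ i) (q ^ (r + 1))) (r + 1),
    Finset.prod_congr rfl fun i _ => thetaSeries_eq (neg_ne_zero.2 (pow_ne_zero _ hq0)) hW0 hW,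
    Finset.prod_mul_distrib, Finset.prod_mul_distrib, Finset.prod_const, Finset.card_range,
    thetaSeries_eq (by norm_num) hq0 hq, qPoch_eq_prod (-1) hq r.succ_pos,
    qPoch_eq_prod (q / -1) hq r.succ_pos,
    ← Finset.prod_range_reflect (fun i => qPoch (q ^ (r + 1) / -q ^ i) (q ^ (r + 1)))]
  have h : ∀ i ∈ Finset.range (r + 1), qPoch (q ^ (r + 1) / -q ^ (r + 1 - 1 - i)) (q ^ (r + 1)) =
      qPoch (q / -1 * q ^ i) (q ^ (r + 1)) := fun i hi => by
    have hi := Finset.mem_range.1 hi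
    rw [div_eq_iff (neg_ne_zero.2 (pow_ne_zero _ hq0)) |>.2]
    rw [div_neg, div_one, neg_mul, neg_mul_neg, ← pow_succ', ← pow_add]; congr 1; lia
  rw [Finset.prod_congr rfl h]
  simp only [neg_mul, one_mul, Nat.succ_eq_add_one]
  field_simp

lemma thetaSeries_neg_one_ne_zero {q : ℂ} (hq0 : q ≠ 0) (hq : ‖q‖ < 1) :
    thetaSeries (-1) q ≠ 0 := by
  rw [thetaSeries_eq (by norm_num) hq0 hq]
  refine mul_ne_zero (mul_ne_zero (qPoch_ne_zero_of_norm_lt hq hq) ?_)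
    (qPoch_ne_zero_of_norm_lt hq (by simpa using hq))
  refine qPoch_ne_zero hq fun n h => ?_
  rcases Nat.eq_zero_or_pos n with rfl | hn
  · norm_num at h
  · have h1 := norm_pow_lt_one hq hn
    have h2 : q ^ n = -1 := by linear_combination -h
    rw [h2] at h1
    simp at h1

/-! ### The generating function of cores. -/

/-- The quadratic form whose values on vectors of sum zero enumerate `r + 1` cores. -/
def coreForm {r : ℕ} (n : Fin (r + 1) → ℤ) : ℤ := ∑ i, ((r + 1) * tri (n i) + i * n i)

lemma coreForm_nonneg {r : ℕ} {n : Fin (r + 1) → ℤ} (hn : ∑ i, n i = 0) : 0 ≤ coreForm n := by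
  have h1 := sum_tri_le_coreExponent n
  -- Here `n` has `r + 1` entries, so `coreExponent` carries the factor `r + 2`; the surplus `∑ tri
  -- (n i)` is exactly the lower bound in `h1`.
  have h2 : coreExponent n = coreForm n + ∑ i, tri (n i) + ∑ i, n i := by
    rw [coreExponent, coreForm, hn, ← Finset.sum_add_distrib]
    have : tri (0 + 1) = 0 := rfl
    rw [this, sub_zero, ← hn, ← Finset.sum_add_distrib]
    refine Finset.sum_congr rfl fun i _ => ?_
    push_cast
    ring
  linarith

/-- Cyclic rotation, raising the sum by one. -/
def coreRotate (r : ℕ) : (Fin (r + 1) → ℤ) ≃ (Fin (r + 1) → ℤ) where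
  toFun n := Fin.cons (n (Fin.last r) + 1) fun i : Fin r => n i.castSucc
  invFun n := Fin.snoc (α := fun _ => ℤ) (fun i : Fin r => n i.succ) (n 0 - 1)
  left_inv n := by
    funext i
    refine Fin.lastCases ?_ (fun i => ?_) i <;> simp
  right_inv n := by
    funext i
    refine Fin.cases ?_ (fun i => ?_) i <;> simp

lemma sum_coreRotate {r : ℕ} (n : Fin (r + 1) → ℤ) : ∑ i, coreRotate r n i = ∑ i, n i + 1 := by
  simp only [coreRotate, Equiv.coe_fn_mk, Fin.sum_univ_succ (n := r), Fin.cons_zero, Fin.cons_succ]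
  rw [← Fin.sum_univ_succ, Fin.sum_univ_castSucc]
  ring

lemma coreForm_coreRotate {r : ℕ} (n : Fin (r + 1) → ℤ) :
    coreForm (coreRotate r n) = coreForm n + ∑ i, n i := by
  have h1 : coreForm (coreRotate r n) = (r + 1) * tri (n (Fin.last r) + 1) +
      ∑ i : Fin r, ((r + 1) * tri (n i.castSucc) + (i + 1) * n i.castSucc) := by
    simp [coreForm, coreRotate, Fin.sum_univ_succ]
  rw [h1, coreForm, Fin.sum_univ_castSucc, Fin.sum_univ_castSucc, tri_add_one]
  simp only [Finset.sum_add_distrib, add_mul, Fin.val_last, Fin.val_castSucc, one_mul]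
  ring

lemma hasSum_coreForm {q : ℂ} (hq0 : q ≠ 0) (hq : ‖q‖ < 1) (r : ℕ) :
    HasSum (fun n : Fin (r + 1) → ℤ => q ^ coreForm n)
      (∏ i : Fin (r + 1), thetaSeries (-q ^ (i : ℕ)) (q ^ (r + 1))) := by
  have h := (summable_hasSum_pi (r := r + 1)
    (fun i n => (-1) ^ n * (-q ^ (i : ℕ)) ^ n * (q ^ (r + 1)) ^ tri n)
    fun i => summable_norm_theta (neg_ne_zero.2 (pow_ne_zero _ hq0)) (pow_ne_zero _ hq0)
      (norm_pow_lt_one hq (by lia))).2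
  refine h.congr_fun fun n => ?_
  rw [coreForm, ← prod_zpow_eq_zpow_sum _ hq0]
  refine Finset.prod_congr rfl fun i _ => ?_
  rw [← mul_zpow, neg_one_mul, neg_neg, zpow_add₀ hq0, zpow_mul, zpow_mul, mul_comm, zpow_natCast]
  congr 2

/-- The generating function of `r + 1` cores as a theta series. -/
theorem hasSum_cores {q : ℂ} (hq0 : q ≠ 0) (hq : ‖q‖ < 1) (r : ℕ) :
    HasSum (fun n : (fun n : Fin (r + 1) → ℤ => ∑ i, n i) ⁻¹' {0} => q ^ coreForm n.1)
      (qPoch (q ^ (r + 1)) (q ^ (r + 1)) ^ (r + 1) / qPoch q q) := by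
  have hsum := hasSum_coreForm hq0 hq r
  let σ : (Fin (r + 1) → ℤ) → ℤ := fun n => ∑ i, n i
  let X : ℤ → ℂ := fun s => ∑' n : σ ⁻¹' {s}, q ^ coreForm n.1
  have hX : HasSum X _ := hsum.tsum_fiberwise σ
  -- Rotation carries the slice of sum `s` onto that of sum `s + 1`. Hence all slices are multiples
  -- of `X 0`, and the full sum is `thetaSeries (-1) q * X 0`.
  have hstep : ∀ s, X (s + 1) = q ^ s * X s := fun s => by
    simp only [X]
    rw [tsum_subtype (σ ⁻¹' {s + 1}) fun n => q ^ coreForm n,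
      tsum_subtype (σ ⁻¹' {s}) fun n => q ^ coreForm n, ← (coreRotate r).tsum_eq, ← tsum_mul_left]
    refine tsum_congr fun n => ?_
    have hiff : coreRotate r n ∈ σ ⁻¹' {s + 1} ↔ n ∈ σ ⁻¹' {s} := by
      simp [σ, sum_coreRotate]
    by_cases hn : n ∈ σ ⁻¹' {s}
    · have hs : ∑ i, n i = s := hn
      rw [Set.indicator_of_mem (hiff.2 hn), Set.indicator_of_mem hn, coreForm_coreRotate, hs,
        zpow_add₀ hq0, mul_comm]
    · rw [Set.indicator_of_notMem (mt hiff.1 hn), Set.indicator_of_notMem hn, mul_zero]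
  have hall : ∀ s, X s = q ^ tri s * X 0 := fun s => by
    induction s using Int.induction_on with
    | zero => simp [tri]
    | succ i ih => rw [hstep, ih, tri_add_one, zpow_add₀ hq0]; ring
    | pred i ih =>
      have h1 := hstep (-i - 1)
      have h2 := tri_add_one (-i - 1)
      rw [sub_add_cancel] at h1 h2
      have h3 : q ^ ((-i : ℤ) - 1) ≠ 0 := zpow_ne_zero _ hq0
      rw [ih, h2, zpow_add₀ hq0] at h1
      refine mul_left_cancel₀ h3 ?_
      rw [← h1]; ring
  have hth : thetaSeries (-1) q = ∑' s : ℤ, q ^ tri s := by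
    refine tsum_congr fun s => ?_
    rw [← mul_zpow]; simp
  have h0 : X 0 = qPoch (q ^ (r + 1)) (q ^ (r + 1)) ^ (r + 1) / qPoch q q := by
    have h1 := hX.tsum_eq
    rw [tsum_congr hall, tsum_mul_right, ← hth, prod_thetaSeries_neg hq0 hq, mul_comm] at h1
    exact mul_right_cancel₀ (thetaSeries_neg_one_ne_zero hq0 hq) h1
  rw [← h0]
  exact (hsum.summable.subtype _).hasSum

/-! ### Nonnegativity of the theta quotients. -/

lemma nonnegExpansion_cores {t : ℕ} (ht : 0 < t) :
    NonnegExpansion fun q => qPoch (q ^ t) (q ^ t) ^ t / qPoch q q := by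
  obtain ⟨r, rfl⟩ : ∃ r, t = r + 1 := ⟨t - 1, by lia⟩
  exact .of_hasSum_zpow _ (fun n => coreForm_nonneg n.2) fun q h0 hq => hasSum_cores h0 hq r

lemma nonnegExpansion_coreTheta (r : ℕ) {a M : ℕ} (ha : a ≤ M) (hM : 0 < M) :
    NonnegExpansion fun q =>
      ∑' n : Fin r → ℤ, (q ^ a) ^ (∑ i, n i) * (q ^ M) ^ coreExponent n := by
  refine .of_hasSum_zpow (fun n : Fin r → ℤ => a * (∑ i, n i) + M * coreExponent n) (fun n => ?_)
    fun q h0 hq => ?_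
  -- The exponent equals `a (coreExponent n + ∑ n) + (M - a) coreExponent n`.
  · have h1 := coreExponent_nonneg n
    have h2 := coreExponent_add_sum_nonneg n
    have h3 : (0 : ℤ) ≤ M - a := by lia
    nlinarith [mul_nonneg (Int.natCast_nonneg a) h2, mul_nonneg h3 h1]
  · have h := (summable_norm_coreTheta (pow_ne_zero a h0) (pow_ne_zero M h0)
      (norm_pow_lt_one hq hM) r).of_norm.hasSum
    refine h.congr_fun fun n => ?_
    rw [zpow_add₀ h0, zpow_mul, zpow_mul, zpow_natCast, zpow_natCast]

/-- The product of `1 - q ^ m` over the positive `m` congruent to `± a` modulo `M`. -/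
noncomputable def qPochPair (a M : ℕ) (q : ℂ) : ℂ :=
  qPoch (q ^ a) (q ^ M) * qPoch (q ^ (M - a)) (q ^ M)

lemma qPochPair_ne_zero {a M : ℕ} (ha0 : 0 < a) (ha : a < M) {q : ℂ} (hq : ‖q‖ < 1) :
    qPochPair a M q ≠ 0 :=
  mul_ne_zero
    (qPoch_ne_zero_of_norm_lt (norm_pow_lt_one hq (by lia)) (norm_pow_lt_one hq ha0))
    (qPoch_ne_zero_of_norm_lt (norm_pow_lt_one hq (by lia)) (norm_pow_lt_one hq (by lia)))

lemma thetaSeries_pow_pow {a M : ℕ} (ha : a < M) {q : ℂ} (hq0 : q ≠ 0)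
    (hq : ‖q‖ < 1) :
    thetaSeries (q ^ a) (q ^ M) = qPoch (q ^ M) (q ^ M) * qPochPair a M q := by
  rw [thetaSeries_eq (pow_ne_zero _ hq0) (pow_ne_zero _ hq0) (norm_pow_lt_one hq (by lia)),
    qPochPair, mul_assoc, pow_sub₀ q hq0 ha.le, div_eq_mul_inv]

/-- The multiple theta series at `z = q ^ a` and nome `q ^ M` equals the wanted quotient up to
powers of `(q ^ M; q ^ M)` and `(q ^ (M t); q ^ (M t))`; the `t`-core generating function at `q ^ M`
supplies these. -/
theorem nonnegExpansion_qPochPair {a M t : ℕ} (ha0 : 0 < a) (ha : a < M) (ht : 0 < t) :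
    NonnegExpansion fun q =>
      (qPoch (q ^ (M * t)) (q ^ (M * t)) ^ (t - 1)) ^ 2 * qPochPair a M (q ^ t) /
        qPochPair a M q := by
  obtain ⟨r, rfl⟩ : ∃ r, t = r + 1 := ⟨t - 1, by lia⟩
  have hM : 0 < M := by lia
  refine (((nonnegExpansion_cores ht).comp_pow hM).mul
    (nonnegExpansion_coreTheta r ha.le hM)).congr fun q h0 hq => ?_
  have hQ := norm_pow_lt_one hq hM
  have hqt := norm_pow_lt_one hq ht
  have hW := norm_pow_lt_one hQ ht
  have h1 := tsum_coreTheta_mul_thetaSeries (pow_ne_zero a h0) (pow_ne_zero M h0) hQ r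
  have e1 := qPoch_ne_zero_of_norm_lt hQ hQ
  have e2 := qPoch_ne_zero_of_norm_lt hW hW
  have e3 := qPochPair_ne_zero ha0 ha hq
  rw [prod_thetaSeries_succ (pow_ne_zero _ h0) hQ, thetaSeries_pow_pow ha h0 hq,
    ← pow_mul q a, mul_comm a, pow_mul q (r + 1) a, ← pow_mul q M, mul_comm M, pow_mul q (r + 1) M,
    thetaSeries_pow_pow ha (pow_ne_zero _ h0) hqt] at h1
  rw [← pow_mul q M, mul_comm M, pow_mul q (r + 1) M] at e2
  rw [← pow_mul q M, mul_comm M, pow_mul q (r + 1) M, add_tsub_cancel_right]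
  generalize (∑' n : Fin r → ℤ, (q ^ a) ^ (∑ i, n i) * (q ^ M) ^ coreExponent n) = E at *
  generalize qPochPair a M q = A at *
  generalize qPochPair a M (q ^ (r + 1)) = B at *
  generalize qPoch ((q ^ (r + 1)) ^ M) ((q ^ (r + 1)) ^ M) = W at *
  generalize qPoch (q ^ M) (q ^ M) = e at *
  have h2 : E * A * W = W ^ r * e * B := by
    field_simp at h1
    linear_combination h1
  rw [eq_div_iff e3]
  field_simp
  linear_combination W ^ r * h2

/-! ### Products over integers coprime to `N`, and the induction on `N`. -/

/-- The product of `1 - q ^ m` over the positive integers `m` coprime to `N`. -/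
noncomputable def coprimeProd (N : ℕ) (q : ℂ) : ℂ := setProd {m | m ≠ 0 ∧ m.Coprime N} q

lemma coprimeProd_ne_zero (N : ℕ) {q : ℂ} (hq : ‖q‖ < 1) : coprimeProd N q ≠ 0 :=
  setProd_ne_zero hq fun h => h.1 rfl

lemma coprimeProd_one (q : ℂ) : coprimeProd 1 q = qPoch q q := by
  rw [← setProd_ne_zero_eq, coprimeProd]
  simp

lemma coprimeProd_mul_of_dvd {M p : ℕ} (hpM : p ∣ M) (q : ℂ) :
    coprimeProd (M * p) q = coprimeProd M q := by
  unfold coprimeProd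
  congr 1
  ext m
  simp only [Set.mem_ofPred_eq, Nat.coprime_mul_iff_right]
  exact ⟨fun h => ⟨h.1, h.2.1⟩, fun h => ⟨h.1, h.2, h.2.coprime_dvd_right hpM⟩⟩

lemma coprimeProd_mul_of_not_dvd {M p : ℕ} (hp : p.Prime) (hpM : ¬ p ∣ M) {q : ℂ} (hq : ‖q‖ < 1) :
    coprimeProd M q = coprimeProd (M * p) q * coprimeProd M (q ^ p) := by
  have hpM' : p.Coprime M := (Nat.Prime.coprime_iff_not_dvd hp).2 hpM
  have hset : {m : ℕ | m ≠ 0 ∧ m.Coprime M} =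
      {m | m ≠ 0 ∧ m.Coprime (M * p)} ∪ (p * ·) '' {m | m ≠ 0 ∧ m.Coprime M} := by
    ext m
    simp only [Set.mem_union, Set.mem_ofPred_eq, Set.mem_image, Nat.coprime_mul_iff_right]
    constructor
    · rintro ⟨h0, h1⟩
      by_cases h : p ∣ m
      · obtain ⟨k, rfl⟩ := h
        exact Or.inr ⟨k, ⟨by rintro rfl; simp at h0, (Nat.coprime_mul_iff_left.1 h1).2⟩, rfl⟩
      · exact Or.inl ⟨h0, h1, ((Nat.Prime.coprime_iff_not_dvd hp).2 h).symm⟩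
    · rintro (h | ⟨k, ⟨h0, h1⟩, rfl⟩)
      · exact ⟨h.1, h.2.1⟩
      · exact ⟨mul_ne_zero hp.ne_zero h0, Nat.coprime_mul_iff_left.2 ⟨hpM', h1⟩⟩
  have hdisj : Disjoint {m : ℕ | m ≠ 0 ∧ m.Coprime (M * p)}
      ((p * ·) '' {m | m ≠ 0 ∧ m.Coprime M}) := by
    rw [Set.disjoint_left]
    rintro _ ⟨_, h1⟩ ⟨k, _, rfl⟩
    have h2 := (Nat.coprime_mul_iff_left.1 (Nat.coprime_mul_iff_right.1 h1).2).1
    exact hp.one_lt.ne' ((Nat.coprime_self p).1 h2)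
  rw [coprimeProd, coprimeProd, coprimeProd, ← setProd_image_mul _ hp.pos, ← setProd_union hdisj hq,
    ← hset]

/-- Representatives of the reduced residues modulo `M` up to sign. -/
def halfResidues (M : ℕ) : Finset ℕ := {a ∈ Finset.range M | a.Coprime M ∧ 2 * a < M}

lemma mem_halfResidues {M a : ℕ} : a ∈ halfResidues M ↔ a.Coprime M ∧ 2 * a < M := by
  simp only [halfResidues, Finset.mem_filter, Finset.mem_range]
  exact ⟨fun h => h.2, fun h => ⟨by lia, h⟩⟩

lemma pos_of_mem_halfResidues {M a : ℕ} (hM : 3 ≤ M) (ha : a ∈ halfResidues M) : 0 < a := by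
  rw [mem_halfResidues] at ha
  rcases Nat.eq_zero_or_pos a with rfl | h
  · have := ha.1
    rw [Nat.coprime_zero_left] at this
    lia
  · exact h

lemma coprime_sub_left_iff {M a : ℕ} (ha : a ≤ M) : (M - a).Coprime M ↔ a.Coprime M := by
  rw [Nat.coprime_comm, Nat.coprime_self_sub_right ha, Nat.coprime_comm]

lemma two_mul_ne_of_coprime {M a : ℕ} (hM : 3 ≤ M) (ha : a.Coprime M) : 2 * a ≠ M := by
  rintro rfl
  have : a ∣ 1 := by
    rw [← Nat.Coprime.gcd_eq_one ha]
    exact Nat.dvd_gcd dvd_rfl (Dvd.intro_left 2 rfl)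
  have := Nat.le_of_dvd one_pos this
  lia

lemma card_halfResidues {M : ℕ} (hM : 3 ≤ M) : 2 * (halfResidues M).card = M.totient := by
  have hu : {a ∈ Finset.range M | M.Coprime a} =
      halfResidues M ∪ (halfResidues M).image (M - ·) := by
    ext a
    simp only [Finset.mem_filter, Finset.mem_range, Finset.mem_union, Finset.mem_image,
      mem_halfResidues]
    constructor
    · rintro ⟨h1, h2⟩
      have h3 := two_mul_ne_of_coprime hM h2.symm
      rcases lt_or_ge (2 * a) M with h | h
      · exact Or.inl ⟨h2.symm, h⟩
      · exact Or.inr ⟨M - a, ⟨(coprime_sub_left_iff h1.le).2 h2.symm, by lia⟩, by lia⟩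
    · rintro (h | ⟨b, ⟨h1, h2⟩, rfl⟩)
      · exact ⟨by lia, h.1.symm⟩
      · have := pos_of_mem_halfResidues hM (mem_halfResidues.2 ⟨h1, h2⟩)
        exact ⟨by lia, ((coprime_sub_left_iff (by lia)).2 h1).symm⟩
  rw [Nat.totient_eq_card_coprime, hu, Finset.card_union_of_disjoint, Finset.card_image_of_injOn]
  · ring
  · intro a ha b hb h
    have ha := (mem_halfResidues.1 ha).2
    have hb := (mem_halfResidues.1 hb).2
    simp only at h
    lia
  · rw [Finset.disjoint_left]
    intro a ha h
    obtain ⟨b, hb, rfl⟩ := Finset.mem_image.1 h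
    have ha := (mem_halfResidues.1 ha).2
    have hb := (mem_halfResidues.1 hb).2
    lia

lemma mem_range_progression {a M m : ℕ} (ha : a < M) :
    m ∈ Set.range (fun k => a + M * k) ↔ m % M = a := by
  constructor
  · rintro ⟨k, rfl⟩
    simp [Nat.mod_eq_of_lt ha]
  · rintro rfl
    exact ⟨m / M, Nat.mod_add_div m M⟩

lemma coprimeProd_eq_prod_qPochPair {M : ℕ} (hM : 3 ≤ M) {q : ℂ} (hq : ‖q‖ < 1) :
    coprimeProd M q = ∏ a ∈ halfResidues M, qPochPair a M q := by
  have hset : {m : ℕ | m ≠ 0 ∧ m.Coprime M} = ⋃ a ∈ halfResidues M,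
      (Set.range (fun k => a + M * k) ∪ Set.range (fun k => (M - a) + M * k)) := by
    ext m
    have hmod : m.Coprime M ↔ (m % M).Coprime M := by
      rw [Nat.Coprime, Nat.Coprime, Nat.gcd_comm m, Nat.gcd_rec]
    have hlt := Nat.mod_lt m (show M > 0 by lia)
    simp only [Set.mem_iUnion, Set.mem_union, exists_prop, Set.mem_ofPred_eq]
    constructor
    · rintro ⟨_, h1⟩
      rw [hmod] at h1
      have h3 := two_mul_ne_of_coprime hM h1
      rcases lt_or_ge (2 * (m % M)) M with h | h
      · exact ⟨m % M, mem_halfResidues.2 ⟨h1, h⟩, Or.inl ((mem_range_progression hlt).2 rfl)⟩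
      · refine ⟨M - m % M, mem_halfResidues.2 ⟨(coprime_sub_left_iff hlt.le).2 h1, by lia⟩,
          Or.inr ((mem_range_progression (by lia)).2 (by lia))⟩
    · rintro ⟨a, ha, h⟩
      have ha0 := pos_of_mem_halfResidues hM ha
      rw [mem_halfResidues] at ha
      rw [mem_range_progression (by lia), mem_range_progression (by lia)] at h
      have h1 : m % M ≠ 0 := by lia
      refine ⟨by rintro rfl; simp at h1, hmod.2 ?_⟩
      rcases h with h | h
      · rw [h]; exact ha.1
      · rw [h]; exact (coprime_sub_left_iff (by lia)).2 ha.1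
  rw [coprimeProd, hset, setProd_biUnion _ _ _ hq]
  · refine Finset.prod_congr rfl fun a ha => ?_
    have ha0 := pos_of_mem_halfResidues hM ha
    rw [mem_halfResidues] at ha
    rw [setProd_union _ hq, setProd_progression (by lia), setProd_progression (by lia), qPochPair]
    rw [Set.disjoint_left]
    intro m h1 h2
    rw [mem_range_progression (by lia)] at h1 h2
    lia
  · intro a ha b hb hab
    have ha0 := pos_of_mem_halfResidues hM ha
    have hb0 := pos_of_mem_halfResidues hM hb
    have ha := mem_halfResidues.1 ha
    have hb := mem_halfResidues.1 hb
    rw [Function.onFun, Set.disjoint_left]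
    intro m h1 h2
    rw [Set.mem_union, mem_range_progression (by lia), mem_range_progression (by lia)] at h1 h2
    lia

/-- The generating function `(q ^ N; q ^ N) ^ φ(N) / ∏ (1 - q ^ m)` over `m` coprime to `N` has
nonnegative coefficients. -/
theorem nonnegExpansion_coprimeProd {N : ℕ} (hN : 0 < N) :
    NonnegExpansion fun q => qPoch (q ^ N) (q ^ N) ^ N.totient / coprimeProd N q := by
  induction N using Nat.strong_induction_on with
  | _ N ih =>
  rcases eq_or_ne N 1 with rfl | hN1
  · simpa [coprimeProd_one] using nonnegExpansion_cores one_pos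
  have hp := Nat.minFac_prime hN1
  obtain ⟨M, hM⟩ : N.minFac ∣ N := Nat.minFac_dvd N
  have hmin : ∀ k, 2 ≤ k → k ∣ N → N.minFac ≤ k := fun k => Nat.minFac_le_of_dvd
  generalize N.minFac = p at *
  rw [mul_comm] at hM
  subst hM
  have hM0 : 0 < M := Nat.pos_of_mul_pos_right hN
  by_cases hpM : p ∣ M
  · refine ((ih M (lt_mul_of_one_lt_right hM0 hp.one_lt) hM0).mul
      (((nonnegExpansion_cores hp.pos).comp_pow hM0).pow M.totient)).congr fun q h0 hq => ?_
    have hQ := norm_pow_lt_one hq hM0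
    have h1 := qPoch_ne_zero_of_norm_lt hQ hQ
    have h2 := coprimeProd_ne_zero M hq
    rw [coprimeProd_mul_of_dvd hpM, mul_comm M p, Nat.totient_mul_of_prime_of_dvd hp hpM,
      mul_comm p M, pow_mul q M p, pow_mul _ p, div_pow]
    field_simp
  rcases eq_or_ne M 1 with rfl | hM1
  · refine (nonnegExpansion_cores hp.pos).congr fun q h0 hq => ?_
    have hQ := norm_pow_lt_one hq hp.pos
    have h1 := coprimeProd_mul_of_not_dvd hp hpM hq
    rw [coprimeProd_one, coprimeProd_one] at h1
    have h2 := qPoch_ne_zero_of_norm_lt hq hq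
    have h3 := coprimeProd_ne_zero (1 * p) hq
    have h4 : qPoch (q ^ p) (q ^ p) ^ p =
        qPoch (q ^ p) (q ^ p) ^ (p - 1) * qPoch (q ^ p) (q ^ p) := by
      rw [← pow_succ, Nat.sub_add_cancel hp.pos]
    rw [one_mul] at *
    rw [Nat.totient_prime hp, div_eq_div_iff h2 h3, h4, h1]
    ring
  -- `M = 2` would force `p = 2` by minimality, against `¬ p ∣ M`. This is why the least prime
  -- factor is removed: `a` and `M - a` must be distinct residues.
  have hM3 : 3 ≤ M := by
    rcases Nat.lt_or_ge M 3 with h | h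
    · obtain rfl : M = 2 := by lia
      have h1 := hmin 2 le_rfl ⟨p, rfl⟩
      have h2 := hp.two_le
      exact absurd (show p ∣ 2 by rw [show p = 2 by lia]) hpM
    · exact h
  -- The `φ(M) / 2` pairs each bring `2 (p - 1)` factors `(q ^ N; q ^ N)`, in total `φ(M p)`. The
  -- induction hypothesis plays no role in this case.
  refine (NonnegExpansion.prod (halfResidues M) fun a ha => nonnegExpansion_qPochPair (M := M)
    (pos_of_mem_halfResidues hM3 ha) (by have := (mem_halfResidues.1 ha).2; lia) hp.pos).congr
    fun q h0 hq => ?_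
  have hqp := norm_pow_lt_one hq hp.pos
  have h1 := coprimeProd_mul_of_not_dvd hp hpM hq
  have h2 := coprimeProd_ne_zero (M * p) hq
  have h3 := coprimeProd_ne_zero M hqp
  rw [Finset.prod_div_distrib, Finset.prod_mul_distrib, ← coprimeProd_eq_prod_qPochPair hM3 hq,
    ← coprimeProd_eq_prod_qPochPair hM3 hqp, Finset.prod_const, ← pow_mul, ← pow_mul, h1,
    mul_comm M p, Nat.totient_mul_of_prime_of_not_dvd hp hpM, ← card_halfResidues hM3]
  rw [mul_comm M p] at h2
  field_simp

/-! ### From the eta product to infinite products. -/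

lemma sum_moebius_dvd (N m : ℕ) (hN : 0 < N) :
    ∑ d ∈ N.divisors with d ∣ m, ArithmeticFunction.moebius d = if m.Coprime N then 1 else 0 := by
  have h1 : {d ∈ N.divisors | d ∣ m} = (m.gcd N).divisors := by
    ext d
    simp only [Finset.mem_filter, Nat.mem_divisors, Nat.dvd_gcd_iff]
    exact ⟨fun h => ⟨⟨h.2, h.1.1⟩, (Nat.gcd_pos_of_pos_right m hN).ne'⟩,
      fun h => ⟨⟨h.1.2, hN.ne'⟩, h.1.1⟩⟩
  rw [h1, ← ArithmeticFunction.coe_mul_zeta_apply, ArithmeticFunction.moebius_mul_coe_zeta,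
    ArithmeticFunction.one_apply]

lemma setProd_dvd {d : ℕ} (hd : 0 < d) (q : ℂ) :
    setProd {m | m ≠ 0 ∧ d ∣ m} q = qPoch (q ^ d) (q ^ d) := by
  rw [← setProd_ne_zero_eq, ← setProd_image_mul _ hd]
  congr 1
  ext m
  simp only [Set.mem_ofPred_eq, Set.mem_image]
  constructor
  · rintro ⟨h0, k, rfl⟩
    exact ⟨k, by rintro rfl; simp at h0, rfl⟩
  · rintro ⟨k, hk, rfl⟩
    exact ⟨mul_ne_zero hd.ne' hk, k, rfl⟩

lemma HasProd.zpow_complex {ι : Type*} {f : ι → ℂ} {a : ℂ} (h : HasProd f a) (ha : a ≠ 0) (z : ℤ) :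
    HasProd (fun i => f i ^ z) (a ^ z) := by
  obtain ⟨n, rfl | rfl⟩ := z.eq_nat_or_neg
  · simpa using h.pow n
  · simpa using (h.pow n).inv₀ (pow_ne_zero n ha)

/-- The factor `1 - q ^ m` occurs with exponent the sum of `μ(d)` over `d ∣ gcd(m, N)`. -/
lemma prod_qPoch_zpow_moebius {N : ℕ} (hN : 0 < N) {q : ℂ} (hq : ‖q‖ < 1) :
    ∏ d ∈ N.divisors, qPoch (q ^ d) (q ^ d) ^ ArithmeticFunction.moebius d = coprimeProd N q := by
  have h1 : ∀ d ∈ N.divisors, HasProd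
      (fun m => ({m | m ≠ 0 ∧ d ∣ m} : Set ℕ).mulIndicator (fun m => 1 - q ^ m) m ^
        ArithmeticFunction.moebius d)
      (qPoch (q ^ d) (q ^ d) ^ ArithmeticFunction.moebius d) := fun d hd => by
    rw [← setProd_dvd (Nat.pos_of_mem_divisors hd)]
    exact (multipliable_setProd _ hq).hasProd.zpow_complex
      (setProd_ne_zero hq fun h => h.1 rfl) _
  rw [← (hasProd_prod h1).tprod_eq, coprimeProd, setProd]
  refine tprod_congr fun m => ?_
  rcases Nat.eq_zero_or_pos m with rfl | hm
  · simp
  have hm1 : 1 - q ^ m ≠ 0 := fun h => by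
    have := norm_pow_lt_one hq hm
    rw [← sub_eq_zero.1 h] at this
    simp at this
  have h2 : ∀ d ∈ N.divisors, ({m | m ≠ 0 ∧ d ∣ m} : Set ℕ).mulIndicator (fun m => 1 - q ^ m) m ^
      ArithmeticFunction.moebius d =
      (1 - q ^ m) ^ (if d ∣ m then ArithmeticFunction.moebius d else 0) := fun d _ => by
    by_cases h : d ∣ m <;> simp [Set.mulIndicator, h, hm.ne']
  rw [Finset.prod_congr rfl h2, prod_zpow_eq_zpow_sum _ hm1, ← Finset.sum_filter,
    sum_moebius_dvd N m hN]
  by_cases h : m.Coprime N <;> simp [Set.mulIndicator, h, hm.ne']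

/-- The sum is the product of `1 - p` over the primes `p ∣ N`. The bound makes the leading exponent
of the eta product a natural number. -/
lemma abs_sum_mul_moebius_le_totient {N : ℕ} (hN : 0 < N) :
    |∑ d ∈ N.divisors, (d : ℤ) * ArithmeticFunction.moebius d| ≤ N.totient := by
  let g : ArithmeticFunction ℤ :=
    (ArithmeticFunction.id : ArithmeticFunction ℤ).pmul ArithmeticFunction.moebius *
      (ArithmeticFunction.zeta : ArithmeticFunction ℤ)
  have hgm : g.IsMultiplicative :=
    (ArithmeticFunction.isMultiplicative_id.natCast.pmul
      ArithmeticFunction.isMultiplicative_moebius).mul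
      ArithmeticFunction.isMultiplicative_zeta.natCast
  have hg : ∀ n, g n = ∑ d ∈ n.divisors, (d : ℤ) * ArithmeticFunction.moebius d := fun n => by
    rw [ArithmeticFunction.coe_mul_zeta_apply]
    simp
  rw [← hg]
  induction N using Nat.recOnPosPrimePosCoprime with
  | zero => simp at hN
  | one => simp [hgm.map_one]
  | prime_pow p k hp hk =>
    obtain ⟨k, rfl⟩ : ∃ j, k = j + 1 := ⟨k - 1, by lia⟩
    have h1 : g (p ^ (k + 1)) = 1 - p := by
      rw [hg, Nat.sum_divisors_prime_pow hp, Finset.sum_range_succ', Finset.sum_range_succ']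
      have : ∀ i ∈ Finset.range k, ((p ^ (i + 1 + 1) : ℕ) : ℤ) *
          ArithmeticFunction.moebius (p ^ (i + 1 + 1)) = 0 := fun i _ => by
        rw [ArithmeticFunction.moebius_apply_prime_pow hp (by lia), if_neg (by lia), mul_zero]
      rw [Finset.sum_eq_zero this]
      simp [ArithmeticFunction.moebius_apply_prime hp]
      ring
    have h2 : (0 : ℤ) ≤ (p : ℤ) - 1 := by have := hp.one_lt; lia
    have h3 : (1 : ℤ) ≤ (p : ℤ) ^ k := one_le_pow₀ (by have := hp.one_lt; lia)
    rw [h1, abs_sub_comm, abs_of_nonneg h2, Nat.totient_prime_pow_succ hp]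
    push_cast [hp.one_le]
    nlinarith
  | coprime a b ha hb hab iha ihb =>
    rw [hgm.map_mul_of_coprime hab, abs_mul, Nat.totient_mul hab]
    push_cast
    exact mul_le_mul (iha (by lia)) (ihb (by lia)) (abs_nonneg _) (by positivity)

lemma eta_natCast_mul (d : ℕ) (τ : ℍ) :
    ModularForm.eta (d * (τ : ℂ)) = Function.Periodic.qParam 24 τ ^ d *
      qPoch ((Function.Periodic.qParam 24 τ ^ 24) ^ d) ((Function.Periodic.qParam 24 τ ^ 24) ^ d) := by
  have h1 : Function.Periodic.qParam 24 (d * (τ : ℂ)) = Function.Periodic.qParam 24 τ ^ d := by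
    rw [Function.Periodic.qParam, Function.Periodic.qParam, ← Complex.exp_nat_mul]
    congr 1
    ring
  have h2 : Function.Periodic.qParam 1 (d * (τ : ℂ)) =
      (Function.Periodic.qParam 24 τ ^ 24) ^ d := by
    rw [Function.Periodic.qParam, Function.Periodic.qParam, ← Complex.exp_nat_mul,
      ← Complex.exp_nat_mul]
    congr 1
    push_cast
    ring
  unfold ModularForm.eta ModularForm.eta_q qPoch
  rw [h1, h2]
  simp only [pow_succ']

/-- The eta product is a power of `q ^ (1/24)` times a quotient of infinite products. -/
lemma saitoEtaProduct_eq {N : ℕ} (hN : 0 < N) : ∃ e : ℕ, ∀ τ : ℍ,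
    saitoEtaProduct N τ = Function.Periodic.qParam 24 τ ^ e *
      (qPoch ((Function.Periodic.qParam 24 τ ^ 24) ^ N) ((Function.Periodic.qParam 24 τ ^ 24) ^ N) ^
        N.totient / coprimeProd N (Function.Periodic.qParam 24 τ ^ 24)) := by
  have h1 := abs_sum_mul_moebius_le_totient hN
  have h2 : ∑ d ∈ N.divisors, (d : ℤ) * ArithmeticFunction.moebius d ≤ N * N.totient := by
    have : (N.totient : ℤ) ≤ N * N.totient := by exact_mod_cast Nat.le_mul_of_pos_left _ hN
    exact (le_abs_self _).trans (h1.trans this)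
  refine ⟨(N * N.totient - ∑ d ∈ N.divisors, (d : ℤ) * ArithmeticFunction.moebius d).toNat,
    fun τ => ?_⟩
  have hw0 : Function.Periodic.qParam 24 τ ≠ 0 := Function.Periodic.qParam_ne_zero _
  have hw : ‖Function.Periodic.qParam 24 τ‖ < 1 :=
    Function.Periodic.norm_qParam_lt_one (by norm_num) τ.im_pos
  simp only [saitoEtaProduct, eta_natCast_mul]
  generalize Function.Periodic.qParam 24 τ = w at *
  simp only [mul_zpow, Finset.prod_mul_distrib]
  rw [prod_qPoch_zpow_moebius hN (norm_pow_lt_one hw (by norm_num)), ← zpow_natCast w (Int.toNat _),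
    Int.toNat_of_nonneg (by linarith), zpow_sub₀ hw0, mul_pow, ← prod_zpow_eq_zpow_sum _ hw0,
    mul_div_mul_comm, ← pow_mul]
  have h3 : w ^ ((N : ℤ) * N.totient) = w ^ (N * N.totient) := by
    exact_mod_cast zpow_natCast w (N * N.totient)
  rw [h3]
  congr 2
  exact Finset.prod_congr rfl fun d _ => by rw [zpow_mul, zpow_natCast]

/-! ### Identification of the Fourier coefficients. -/

lemma differentiableOn_saitoEtaProduct {N : ℕ} (hN : 0 < N) :
    DifferentiableOn ℂ (saitoEtaProduct N ∘ UpperHalfPlane.ofComplex) {z | 0 < z.im} := by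
  have hmem : ∀ d : ℕ, 0 < d → ∀ z ∈ {z : ℂ | 0 < z.im}, (d : ℂ) * z ∈
      UpperHalfPlane.upperHalfPlaneSet := fun d hd z hz => by
    have h1 : 0 < z.im := hz
    have h2 : ((d : ℂ) * z).im = d * z.im := by simp
    change 0 < ((d : ℂ) * z).im
    rw [h2]
    positivity
  have heta : ∀ d : ℕ, 0 < d →
      DifferentiableOn ℂ (fun z : ℂ => ModularForm.eta (d * z)) {z | 0 < z.im} :=
    fun d hd z hz => ((ModularForm.differentiableAt_eta_of_mem_upperHalfPlaneSet
      (hmem d hd z hz)).comp z (by fun_prop)).differentiableWithinAt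
  have hne : ∀ d : ℕ, 0 < d → ∀ z ∈ {z : ℂ | 0 < z.im}, ModularForm.eta (d * z) ≠ 0 :=
    fun d hd z hz => ModularForm.eta_ne_zero (hmem d hd z hz)
  have hden : DifferentiableOn ℂ (fun z : ℂ => ∏ d ∈ N.divisors,
      ModularForm.eta (d * z) ^ ArithmeticFunction.moebius d) {z | 0 < z.im} :=
    DifferentiableOn.fun_finsetProd fun d hd => (heta d (Nat.pos_of_mem_divisors hd)).zpow
      (Or.inl fun z hz => hne d (Nat.pos_of_mem_divisors hd) z hz)
  refine (((heta N hN).fun_pow N.totient).fun_div hden fun z hz => ?_).congr fun z hz => ?_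
  · exact Finset.prod_ne_zero_iff.2 fun d hd =>
      zpow_ne_zero _ (hne d (Nat.pos_of_mem_divisors hd) z hz)
  · simp only [Function.comp_apply, saitoEtaProduct, UpperHalfPlane.ofComplex_apply_of_im_pos hz,
      UpperHalfPlane.coe_mk]

/-- A convergent expansion gives periodicity and boundedness at infinity, so the singularity at the
cusp is removable. -/
lemma analyticAt_cuspFunction_of_hasSum {f : ℍ → ℂ} {h : ℝ} (hh : 0 < h) {c : ℕ → ℂ}
    (hd : DifferentiableOn ℂ (f ∘ UpperHalfPlane.ofComplex) {z | 0 < z.im})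
    (hf : ∀ τ : ℍ, HasSum (fun m => c m • Function.Periodic.qParam h τ ^ m) (f τ)) :
    AnalyticAt ℂ (UpperHalfPlane.cuspFunction h f) 0 := by
  refine UpperHalfPlane.analyticAt_cuspFunction_zero hh (fun z => ?_)
    (UpperHalfPlane.mdifferentiable_iff.2 hd)
    (UpperHalfPlane.isBoundedAtImInfty_of_hasSum_qExpansion hh hf)
  rcases lt_or_ge 0 z.im with hz | hz
  · have hz' : 0 < (z + h).im := by simpa using hz
    have h1 := hf (UpperHalfPlane.ofComplex z)
    have h2 := hf (UpperHalfPlane.ofComplex (z + h))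
    rw [UpperHalfPlane.ofComplex_apply_of_im_pos hz] at h1
    rw [UpperHalfPlane.ofComplex_apply_of_im_pos hz'] at h2
    simp only [Function.comp_apply, UpperHalfPlane.ofComplex_apply_of_im_pos hz,
      UpperHalfPlane.ofComplex_apply_of_im_pos hz']
    have hper : Function.Periodic.qParam h (z + h) = Function.Periodic.qParam h z := by
      have hh' : (h : ℂ) ≠ 0 := by exact_mod_cast hh.ne'
      rw [Function.Periodic.qParam, Function.Periodic.qParam, Complex.exp_eq_exp_iff_exists_int]
      exact ⟨1, by field_simp; simp⟩
    simp only [hper] at h2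
    exact h2.unique h1
  -- Off the upper half plane `ofComplex` takes one constant default value, so periodicity is
  -- trivial there.
  · have hz' : (z + h).im ≤ 0 := by simpa using hz
    simp only [Function.comp_apply, UpperHalfPlane.ofComplex_apply_of_im_nonpos hz,
      UpperHalfPlane.ofComplex_apply_of_im_nonpos hz']

lemma exists_nonneg_hasSum_saitoEtaProduct {N : ℕ} (hN : 0 < N) :
    ∃ a : ℕ → ℝ, (∀ m, 0 ≤ a m) ∧ ∀ τ : ℍ,
      HasSum (fun m => (a m : ℂ) • Function.Periodic.qParam 24 τ ^ m) (saitoEtaProduct N τ) := by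
  obtain ⟨e, he⟩ := saitoEtaProduct_eq hN
  have h24 : 0 < 24 := by norm_num
  have hF := (NonnegExpansion.pow_self e).mul ((nonnegExpansion_coprimeProd hN).comp_pow h24)
  obtain ⟨a, ha, hs⟩ := hF
  refine ⟨a, ha, fun τ => ?_⟩
  rw [he]
  simp only [smul_eq_mul]
  exact hs (Function.Periodic.qParam 24 τ) (Function.Periodic.qParam_ne_zero _)
    (Function.Periodic.norm_qParam_lt_one (by norm_num) τ.im_pos)

lemma qExpansion_coeff_eq_of_hasSum {f : ℍ → ℂ} {h : ℝ} (hh : 0 < h) {c : ℕ → ℂ}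
    (han : AnalyticAt ℂ (UpperHalfPlane.cuspFunction h f) 0)
    (hf : ∀ τ : ℍ, HasSum (fun m => c m • Function.Periodic.qParam h τ ^ m) (f τ)) (m : ℕ) :
    (UpperHalfPlane.qExpansion h f).coeff m = c m := by
  have h1 := (UpperHalfPlane.hasFPowerSeriesOnBall_cuspFunction hh han hf).hasFPowerSeriesAt
  have h2 := congrArg (FormalMultilinearSeries.coeff · m)
    (han.hasFPowerSeriesAt.eq_formalMultilinearSeries h1)
  rw [UpperHalfPlane.qExpansion_coeff]
  simpa [div_eq_mul_inv, mul_comm, FormalMultilinearSeries.coeff_ofScalars] using h2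

theorem mainTheorem1 (N : ℕ) (hN : 0 < N) :
    (∀ τ : ℍ, HasSum
      (fun m : ℕ => saitoFourierCoeff N m *
        Complex.exp (2 * Real.pi * Complex.I * m * (τ : ℂ) / 24))
      (saitoEtaProduct N τ)) ∧
    ∀ m : ℕ, (saitoFourierCoeff N m).im = 0 ∧ 0 ≤ (saitoFourierCoeff N m).re := by
  have h24 : (0 : ℝ) < 24 := by norm_num
  obtain ⟨a, ha, hsum⟩ := exists_nonneg_hasSum_saitoEtaProduct hN
  -- Uniqueness of the power series of the cusp function at `0`.
  have hcoeff : ∀ m, saitoFourierCoeff N m = a m := fun m => by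
    rw [saitoFourierCoeff]
    exact qExpansion_coeff_eq_of_hasSum h24
      (analyticAt_cuspFunction_of_hasSum h24 (differentiableOn_saitoEtaProduct hN) hsum) hsum m
  refine ⟨fun τ => ?_, fun m => ?_⟩
  · refine (hsum τ).congr_fun fun m => ?_
    rw [hcoeff, smul_eq_mul, Function.Periodic.qParam, ← Complex.exp_nat_mul]
    congr 2
    push_cast
    ring
  · rw [hcoeff]
    exact ⟨Complex.ofReal_im _, ha m⟩
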